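/- All algebras are unital algebras over $\mathbb{C}$. A Hopf $*$-algebra is a Hopf algebra $Q$ that is a $*$-algebra such that $\Delta$ is a $*$-homomorphism and $S(S(x)^*)^*=x$ for all $x$. An action of $Q$ on a $*$-algebra $M$ is a left module structure with $q\cdot(xy)=(q_1\cdot x)(q_2\cdot y)$, $q\cdot 1=\varepsilon(q)1$ and $(q\cdot x)^*=S(q)^*\cdot x^*$. For an inclusion $N\subset M$ of $*$-algebras, the quantum Galois group $\mathrm{QGal}(N\subset M)$ is the terminal object in the category of Hopf $*$-algebras acting on $M$ with $q\cdot n=\varepsilon(q)n$ for $n\in N$, morphisms being the Hopf $*$-algebra homomorphisms that intertwine the actions. For a finite-dimensional $*$-algebra $B$, $Q_{aut}(B)=\mathrm{QGal}(\mathbb{C}\subset B)$ is the universal Hopf $*$-algebra acting on $B$. For a set $S$ of operators on $B$, the Hopf centralizer $\mathcal{H}\mathrm{C}_{Q_{aut}(B)}(S)$ is the largest Hopf $*$-subalgebra of $Q_{aut}(B)$ all of whose elements act on $B$ by operators commuting with every element of $S$. Let $H$ be a compact quantum group algebra with involutive antipode, that is, a Hopf $*$-algebra with $S^2=\mathrm{id}$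 and a faithful Haar state $\tau$. Let $H^{cop}$ be $H$ with the reversed comultiplication. Let $A\neq 0$ be a $*$-algebra with an $H^{cop}$-action that is outer: $A'\cap (A\rtimes H^{cop})=\mathbb{C}1$ in the smash product $A\rtimes H^{cop}$. Let $B$ be a finite-dimensional $*$-algebra with a right $H$-coaction $\beta(b)=b_0\otimes b_1$ that is a $*$-homomorphism. Let $$C=(B\otimes A\rtimes H^{cop})^{H^{cop}}\subset B\otimes (A\rtimes H^{cop})$$ be the $*$-algebra of all $x$ with $(\beta\odot\pi)(x)=x\otimes 1$, where $(\beta\odot\pi)(b\otimes a\rtimes h)=b_0\otimes a\rtimes h_2\otimes h_1S(b_1)$ (Sweedler notation in $H$). It contains $A$ via $a\mapsto 1\otimes a\rtimes 1$. Let $\widehat{H^{cop}}$ be the space of functionals $\tau(\,\cdot\,S(h))$, $h\in H$, on $H$, acting on $B$ by $\Lambda(\omega)b=b_0\,\omega(b_1)$. 1. The Hopf centralizer $\mathcal{H}\mathrm{C}_{Q_{aut}(B)}(\Lambda(\widehat{H^{cop}}))$ and the quantum Galois group $\mathrm{QGal}(A\subset C)$ exist, and as Hopf $*$-algebras $$\mathrm{QGal}\bigl(A\subset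 (B\otimes A\rtimes H^{cop})^{H^{cop}}\bigr)\;\cong\;\mathcal{H}\mathrm{C}_{Q_{aut}(B)}\bigl(\Lambda(\widehat{H^{cop}})\bigr).$$ 2. In particular, let $\mathcal{R}\subset M$ be a subfactor of the form that Banica's description gives to the vertical subfactor of a commuting square with $\mathbb{C}$ in the corner: $\mathcal{R}$ is the hyperfinite $\mathrm{II}_1$ factor with an outer $H^{cop}$-action, $M$ is a $\mathrm{II}_1$ factor, $P$ is a finite-dimensional $C^*$-algebra with a right $H$-coaction that is a $*$-homomorphism, and $M\cong (P\otimes \mathcal{R}\rtimes H^{cop})^{H^{cop}}$ as $*$-algebras, by an isomorphism that is the canonical inclusion on $\mathcal{R}$. Then $$\mathrm{QGal}(\mathcal{R}\subset M)\;\cong\;\mathcal{H}\mathrm{C}_{Q_{aut}(P)}\bigl(\Lambda(\widehat{H^{cop}})\bigr).$$ -/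

import Mathlib

open scoped TensorProduct
open Coalgebra HopfAlgebra

set_option maxSynthPendingDepth 3
set_option synthInstance.maxHeartbeats 200000

namespace QuantumGalois

universe u v w

/-- A Hopf `*`-algebra over `ℂ`: the algebra is a `*`-algebra (conjugate-linear involutive
anti-automorphism), `Δ` is a `*`-homomorphism, and `S(S(x)^*)^* = x`.
That `ε` is a `*`-homomorphism is a consequence, see `counit_star`. -/
class HopfStarAlgebra (H : Type*) [Ring H] [StarRing H] [HopfAlgebra ℂ H] : Prop
    extends StarModule ℂ H where
  comul_star : ∀ x : H, comul (R := ℂ) (star x) = star (comul (R := ℂ) x)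
  star_antipode_star_antipode : ∀ x : H, star (antipode ℂ (star (antipode ℂ x))) = x

/-- A left action of the Hopf `*`-algebra `Q` on the `*`-algebra `M`, making `M` a module
`*`-algebra: `M` is a left `Q`-module (`toAlgHom`), `q · (xy) = (q₁ · x)(q₂ · y)`,
`q · 1 = ε(q) 1` and `(q · x)^* = S(q)^* · x^*`. -/
structure HopfAction (Q M : Type*) [Ring Q] [StarRing Q] [HopfAlgebra ℂ Q]
    [Ring M] [StarRing M] [Algebra ℂ M] where
  toAlgHom : Q →ₐ[ℂ] Module.End ℂ M
  map_mul' : ∀ (q : Q) (x y : M), toAlgHom q (x * y) =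
    TensorProduct.lift ((LinearMap.mul ℂ M).compl₁₂
      (toAlgHom.toLinearMap.flip x) (toAlgHom.toLinearMap.flip y)) (comul (R := ℂ) q)
  map_one' : ∀ q : Q, toAlgHom q 1 = counit (R := ℂ) q • (1 : M)
  map_star' : ∀ (q : Q) (x : M),
    star (toAlgHom q x) = toAlgHom (star (antipode ℂ q)) (star x)

theorem counit_star {K : Type*} [Ring K] [StarRing K] [HopfAlgebra ℂ K] [HopfStarAlgebra K]
    (x : K) : counit (R := ℂ) (star x) = star (counit (R := ℂ) x) := by
  let e : K →ₗ[ℂ] ℂ :=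
    { toFun := fun x => star (counit (R := ℂ) (star x))
      map_add' := by intros; simp
      map_smul' := by intros; simp }
  have h1 : ∀ t : K ⊗[ℂ] K, TensorProduct.lid ℂ K (e.rTensor K t) =
      star (TensorProduct.lid ℂ K ((counit (R := ℂ)).rTensor K (star t))) := by
    intro t
    induction t with
    | zero => simp
    | add x y hx hy => simp only [map_add, star_add, hx, hy]
    | tmul u v => simp [e]
  have h2 : TensorProduct.lid ℂ K (e.rTensor K (comul (R := ℂ) x)) = x := by
    rw [h1, ← HopfStarAlgebra.comul_star, Coalgebra.rTensor_counit_comul]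
    simp
  have h3 : ∀ t : K ⊗[ℂ] K, counit (R := ℂ) (TensorProduct.lid ℂ K (e.rTensor K t)) =
      e (TensorProduct.rid ℂ K ((counit (R := ℂ)).lTensor K t)) := by
    intro t
    induction t with
    | zero => simp
    | add x y hx hy => simp only [map_add, hx, hy]
    | tmul u v => simp [mul_comm]
  have h4 := h3 (comul (R := ℂ) x)
  rw [h2, Coalgebra.lTensor_counit_comul] at h4
  simp only [TensorProduct.rid_tmul, one_smul] at h4
  rw [h4]
  simp [e]

/-- The linear map `x ↦ S(x^*)^*`. -/
noncomputable def starAntipode (K : Type*) [Ring K] [StarRing K] [HopfAlgebra ℂ K]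
    [HopfStarAlgebra K] : K →ₗ[ℂ] K where
  toFun x := star (antipode ℂ (star x))
  map_add' := by intros; simp
  map_smul' := by intros; simp

theorem mul_starAntipode {K : Type*} [Ring K] [StarRing K] [HopfAlgebra ℂ K] [HopfStarAlgebra K]
    (x : K) : TensorProduct.lift ((LinearMap.mul ℂ K).flip.comp (starAntipode K))
      (comul (R := ℂ) x) = algebraMap ℂ K (counit (R := ℂ) x) := by
  have h1 : ∀ t : K ⊗[ℂ] K,
      TensorProduct.lift ((LinearMap.mul ℂ K).flip.comp (starAntipode K)) t =
      star (LinearMap.mul' ℂ K ((antipode ℂ).rTensor K (star t))) := by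
    intro t
    induction t with
    | zero => simp
    | add x y hx hy => simp only [map_add, star_add, hx, hy]
    | tmul u v => simp [starAntipode]
  rw [h1, ← HopfStarAlgebra.comul_star, mul_antipode_rTensor_comul_apply, counit_star,
    ← algebraMap_star_comm, star_star]

section Smash
variable {K A : Type*} [Ring K] [StarRing K] [HopfAlgebra ℂ K]
  [Ring A] [StarRing A] [Algebra ℂ A]

/-- The smash product `A ⋊ K` of a module `*`-algebra `A` by `K`. The underlying vector space is
`A ⊗ K`; the product is `(a ⋊ h)(b ⋊ g) = a (h₁ · b) ⋊ h₂ g` (see `Smash.tmul_mul_tmul`) and the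
involution is `(a ⋊ h)^* = (1 ⋊ h^*)(a^* ⋊ 1)` (see `Smash.star_tmul`). -/
def Smash (_α : HopfAction K A) : Type _ := A ⊗[ℂ] K

set_option linter.unusedSectionVars false
namespace Smash
variable (α : HopfAction K A)

noncomputable instance : AddCommGroup (Smash α) := inferInstanceAs (AddCommGroup (A ⊗[ℂ] K))
noncomputable instance : Module ℂ (Smash α) := inferInstanceAs (Module ℂ (A ⊗[ℂ] K))

/-- The element `a ⋊ k`. -/
noncomputable def tmul (a : A) (k : K) : Smash α := a ⊗ₜ[ℂ] k

/-- `h` acts on `A ⊗ K` by `h · (b ⊗ g) = h₁ · b ⊗ h₂ g`. -/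
noncomputable def actHom : K →ₐ[ℂ] Module.End ℂ (A ⊗[ℂ] K) :=
  ((Module.endTensorEndAlgHom (R := ℂ) (A := ℂ) (M := A) (N := K)).comp
    (Algebra.TensorProduct.map α.toAlgHom (Algebra.lmul ℂ K))).comp (Bialgebra.comulAlgHom ℂ K)

/-- The product of the smash product, as a linear map: `(a ⊗ h) ↦ (b ⊗ g ↦ a (h₁ · b) ⊗ h₂ g)`. -/
noncomputable def mulMap : A ⊗[ℂ] K →ₗ[ℂ] Module.End ℂ (A ⊗[ℂ] K) :=
  TensorProduct.lift ((LinearMap.mul ℂ (Module.End ℂ (A ⊗[ℂ] K))).compl₁₂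
    ((LinearMap.rTensorHom K) ∘ₗ LinearMap.mul ℂ A) (actHom α).toLinearMap)

/-- Left multiplication by `a` on the first leg. -/
noncomputable def leftMul : A →ₗ[ℂ] Module.End ℂ (A ⊗[ℂ] K) :=
  LinearMap.rTensorHom K ∘ₗ LinearMap.mul ℂ A

theorem mulMap_tmul (a : A) (h : K) : mulMap α (a ⊗ₜ h) = leftMul a * actHom α h := rfl

theorem leftMul_tmul (a b : A) (k : K) :
    leftMul a (b ⊗ₜ[ℂ] k) = (a * b) ⊗ₜ[ℂ] k := rfl

theorem leftMul_mul (a b : A) :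
    (leftMul (a * b) : Module.End ℂ (A ⊗[ℂ] K)) = leftMul a * leftMul b := by
  apply TensorProduct.ext'
  intro x y
  simp [leftMul_tmul, mul_assoc]

theorem leftMul_one : (leftMul (1 : A) : Module.End ℂ (A ⊗[ℂ] K)) = 1 := by
  apply TensorProduct.ext'
  intro x y
  simp [leftMul_tmul]

/-- `h ⊗ k` acts on `A ⊗ K` by `b ⊗ g ↦ h · b ⊗ k g`. -/
noncomputable def diagAct : K ⊗[ℂ] K →ₐ[ℂ] Module.End ℂ (A ⊗[ℂ] K) :=
  (Module.endTensorEndAlgHom (R := ℂ) (A := ℂ) (M := A) (N := K)).comp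
    (Algebra.TensorProduct.map α.toAlgHom (Algebra.lmul ℂ K))

theorem diagAct_tmul (h k : K) (a : A) (g : K) :
    diagAct α (h ⊗ₜ k) (a ⊗ₜ g) = α.toAlgHom h a ⊗ₜ (k * g) := by
  simp [diagAct, Module.endTensorEndAlgHom]

theorem actHom_apply (h : K) : actHom α h = diagAct α (comul (R := ℂ) h) := rfl

theorem actHom_mul_leftMul (h : K) (b : A) :
    actHom α h * leftMul b = TensorProduct.lift
      ((LinearMap.mul ℂ (Module.End ℂ (A ⊗[ℂ] K))).compl₁₂
        (leftMul ∘ₗ α.toAlgHom.toLinearMap.flip b) (actHom α).toLinearMap) (comul (R := ℂ) h) := by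
  let X : K ⊗[ℂ] (K ⊗[ℂ] K) →ₗ[ℂ] Module.End ℂ (A ⊗[ℂ] K) := TensorProduct.lift
      ((LinearMap.mul ℂ (Module.End ℂ (A ⊗[ℂ] K))).compl₁₂
        (leftMul ∘ₗ α.toAlgHom.toLinearMap.flip b) (diagAct α).toLinearMap)
  have h1 : ∀ t : K ⊗[ℂ] K, diagAct α t * leftMul b =
      X (TensorProduct.assoc ℂ K K K ((comul (R := ℂ)).rTensor K t)) := by
    intro t
    induction t with
    | zero => simp
    | add x y hx hy => simp only [map_add, add_mul, hx, hy]
    | tmul x y =>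
      apply TensorProduct.ext'
      intro a k
      simp only [Module.End.mul_apply, leftMul_tmul, diagAct_tmul, α.map_mul',
        LinearMap.rTensor_tmul]
      generalize comul (R := ℂ) x = s
      induction s with
      | zero => simp
      | add u v hu hv =>
        simp only [map_add, TensorProduct.add_tmul, LinearMap.add_apply, hu, hv]
      | tmul u v => simp [X, diagAct_tmul, leftMul_tmul]
  have h2 : ∀ t : K ⊗[ℂ] K, X ((comul (R := ℂ)).lTensor K t) = TensorProduct.lift
      ((LinearMap.mul ℂ (Module.End ℂ (A ⊗[ℂ] K))).compl₁₂
        (leftMul ∘ₗ α.toAlgHom.toLinearMap.flip b) (actHom α).toLinearMap) t := by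
    intro t
    induction t with
    | zero => simp
    | add x y hx hy => simp only [map_add, hx, hy]
    | tmul x y => simp [X, actHom_apply]
  rw [actHom_apply, h1, Coalgebra.coassoc_apply, h2]

theorem mulMap_mulMap (x y : A ⊗[ℂ] K) : mulMap α (mulMap α x y) = mulMap α x * mulMap α y := by
  induction x with
  | zero => simp
  | add x y hx hy => simp only [map_add, LinearMap.add_apply, add_mul, hx, hy]
  | tmul a h =>
  induction y with
  | zero => simp
  | add x y hx hy => simp only [map_add, mul_add, hx, hy]
  | tmul b g =>
    have : leftMul a * actHom α h * (leftMul b * actHom α g) =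
      leftMul a * (actHom α h * leftMul b) * actHom α g := by simp only [mul_assoc]
    rw [mulMap_tmul, mulMap_tmul, this, actHom_mul_leftMul, Module.End.mul_apply, actHom_apply]
    generalize comul (R := ℂ) h = t
    induction t with
    | zero => simp
    | add x y hx hy => simp only [map_add, LinearMap.add_apply, mul_add, add_mul, hx, hy]
    | tmul u v =>
      rw [diagAct_tmul, leftMul_tmul, mulMap_tmul]
      simp [leftMul_mul, mul_assoc]

theorem actHom_one_tmul (h g : K) : actHom α h (1 ⊗ₜ g) = 1 ⊗ₜ (h * g) := by
  rw [actHom_apply]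
  have h1 : ∀ t : K ⊗[ℂ] K, diagAct α t (1 ⊗ₜ g) =
      TensorProduct.lift ((TensorProduct.mk ℂ A K).compl₁₂ ((LinearMap.toSpanSingleton ℂ A 1))
        (LinearMap.mulRight ℂ g)) ((counit (R := ℂ)).rTensor K t) := by
    intro t
    induction t with
    | zero => simp
    | add x y hx hy => simp only [map_add, LinearMap.add_apply, hx, hy]
    | tmul u v => simp [diagAct_tmul, α.map_one', TensorProduct.smul_tmul']
  rw [h1, Coalgebra.rTensor_counit_comul]
  simp

noncomputable instance : Mul (Smash α) := ⟨fun x y => mulMap α x y⟩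
noncomputable instance : One (Smash α) := ⟨(1 : A) ⊗ₜ[ℂ] (1 : K)⟩

theorem mul_def (x y : Smash α) : x * y = (mulMap α x y : A ⊗[ℂ] K) := rfl
theorem one_def : (1 : Smash α) = tmul α 1 1 := rfl

noncomputable instance : Ring (Smash α) :=
  { (inferInstance : AddCommGroup (Smash α)) with
    mul := (· * ·)
    one := 1
    left_distrib := fun x y z => (mulMap α x).map_add y z
    right_distrib := fun x y z => by
      exact (congrArg (fun f : Module.End ℂ (A ⊗[ℂ] K) => f z) ((mulMap α).map_add x y))
    zero_mul := fun x => by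
      exact (congrArg (fun f : Module.End ℂ (A ⊗[ℂ] K) => f x) ((mulMap α).map_zero))
    mul_zero := fun x => (mulMap α x).map_zero
    mul_assoc := fun x y z => by
      exact (congrArg (fun f : Module.End ℂ (A ⊗[ℂ] K) => f z) (mulMap_mulMap α x y))
    one_mul := fun x => by
      change (leftMul (1 : A) * actHom α (1 : K) : Module.End ℂ (A ⊗[ℂ] K)) x = x
      rw [leftMul_one, map_one]
      rfl
    mul_one := fun x => by
      change mulMap α x (1 ⊗ₜ 1) = x
      induction x using TensorProduct.induction_on with
      | zero => simp
      | add x y hx hy =>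
        refine (congrArg (fun f : Module.End ℂ (A ⊗[ℂ] K) => f (1 ⊗ₜ 1)) ((mulMap α).map_add x y)).trans ?_
        exact congrArg₂ (· + ·) hx hy
      | tmul a h =>
        rw [mulMap_tmul, Module.End.mul_apply, actHom_one_tmul, leftMul_tmul, mul_one, mul_one] }

noncomputable instance : Algebra ℂ (Smash α) :=
  Algebra.ofModule
    (fun r x y => (congrArg (fun f : Module.End ℂ (A ⊗[ℂ] K) => f y) ((mulMap α).map_smul r x)))
    (fun r x y => (mulMap α x).map_smul r y)

theorem tmul_mul_tmul (a b : A) (h g : K) {ι : Type*} (r : Coalgebra.Repr ℂ h ι) :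
    tmul α a h * tmul α b g =
      ∑ i ∈ r.index, tmul α (a * α.toAlgHom (r.left i) b) (r.right i * g) := by
  change (leftMul a * actHom α h : Module.End ℂ (A ⊗[ℂ] K)) (b ⊗ₜ g) = _
  rw [Module.End.mul_apply, actHom_apply, ← r.eq, map_sum, LinearMap.sum_apply, map_sum]
  refine Finset.sum_congr rfl fun i _ => ?_
  rw [diagAct_tmul, leftMul_tmul]
  rfl

theorem tmul_one_mul (a b : A) (h : K) : tmul α a 1 * tmul α b h = tmul α (a * b) h := by
  change (leftMul a * actHom α 1 : Module.End ℂ (A ⊗[ℂ] K)) (b ⊗ₜ h) = _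
  rw [map_one, mul_one, leftMul_tmul]
  rfl

theorem mul_one_tmul (a : A) (h g : K) : tmul α a h * tmul α 1 g = tmul α a (h * g) := by
  change (leftMul a * actHom α h : Module.End ℂ (A ⊗[ℂ] K)) (1 ⊗ₜ g) = _
  rw [Module.End.mul_apply, actHom_one_tmul, leftMul_tmul, mul_one]
  rfl

theorem induction_on {p : Smash α → Prop} (x : Smash α) (zero : p 0)
    (tmul : ∀ a h, p (tmul α a h)) (add : ∀ x y, p x → p y → p (x + y)) : p x :=
  TensorProduct.induction_on x zero tmul add

theorem tmul_eq (a : A) (h : K) : tmul α a h = tmul α a 1 * tmul α 1 h := by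
  rw [tmul_one_mul, mul_one]

/-- The identification of the vector space underlying `A ⋊ K` with `A ⊗ K`. -/
noncomputable def equivTensor : Smash α ≃ₗ[ℂ] A ⊗[ℂ] K := LinearEquiv.refl ℂ _

@[simp]
theorem equivTensor_tmul (a : A) (k : K) : equivTensor α (tmul α a k) = a ⊗ₜ k := rfl

@[simp]
theorem equivTensor_symm_tmul (a : A) (k : K) : (equivTensor α).symm (a ⊗ₜ k) = tmul α a k := rfl

/-- The canonical right `K`-coaction `π(a ⋊ h) = (a ⋊ h₁) ⊗ h₂` on `A ⋊ K`. -/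
noncomputable def coaction : Smash α →ₗ[ℂ] Smash α ⊗[ℂ] K :=
  ((equivTensor α).symm.toLinearMap.rTensor K) ∘ₗ
    (TensorProduct.assoc ℂ A K K).symm.toLinearMap ∘ₗ
    (comul (R := ℂ)).lTensor A ∘ₗ (equivTensor α).toLinearMap

/-- The inclusion `h ↦ 1 ⋊ h`. -/
noncomputable def ofRight : K →ₗ[ℂ] Smash α :=
  (equivTensor α).symm.toLinearMap ∘ₗ TensorProduct.mk ℂ A K 1

theorem coaction_tmul (a : A) (h : K) :
    coaction α (tmul α a h) = (tmul α a 1 ⊗ₜ 1) * (ofRight α).rTensor K (comul (R := ℂ) h) := by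
  simp only [coaction, LinearMap.comp_apply, LinearEquiv.coe_coe, equivTensor_tmul,
    LinearMap.lTensor_tmul]
  generalize comul (R := ℂ) h = t
  induction t with
  | zero => simp
  | add x y hx hy => simp only [TensorProduct.tmul_add, map_add, hx, hy, mul_add]
  | tmul u v => simp [ofRight, tmul_one_mul]

theorem coaction_left (a : A) (x : Smash α) :
    coaction α (tmul α a 1 * x) = (tmul α a 1 ⊗ₜ 1) * coaction α x := by
  induction x using induction_on with
  | zero => simp
  | add x y hx hy => simp only [mul_add, map_add, hx, hy]
  | tmul b h =>
    rw [tmul_one_mul, coaction_tmul, coaction_tmul, ← mul_assoc,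
      Algebra.TensorProduct.tmul_mul_tmul, tmul_one_mul, mul_one]

theorem rTensor_ofRight_mul (s t : K ⊗[ℂ] K) :
    (ofRight α).rTensor K (s * t) = (ofRight α).rTensor K s * (ofRight α).rTensor K t := by
  induction s with
  | zero => simp
  | add x y hx hy => simp only [add_mul, map_add, hx, hy]
  | tmul u v =>
  induction t with
  | zero => simp
  | add x y hx hy => simp only [mul_add, map_add, hx, hy]
  | tmul u' v' => simp [ofRight, mul_one_tmul]

theorem coaction_right (x : Smash α) (g : K) :
    coaction α (x * tmul α 1 g) =
      coaction α x * (ofRight α).rTensor K (comul (R := ℂ) g) := by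
  induction x using induction_on with
  | zero => simp
  | add x y hx hy => simp only [add_mul, map_add, hx, hy]
  | tmul b h =>
    rw [mul_one_tmul, coaction_tmul, coaction_tmul, mul_assoc, Bialgebra.comul_mul,
      rTensor_ofRight_mul]

theorem coaction_mid (h : K) (b : A) :
    coaction α (tmul α 1 h * tmul α b 1) =
      (ofRight α).rTensor K (comul (R := ℂ) h) * (tmul α b 1 ⊗ₜ 1) := by
  have h0 : ∀ k : K, tmul α 1 k * tmul α b 1 =
      (equivTensor α).symm ((α.toAlgHom.toLinearMap.flip b).rTensor K (comul (R := ℂ) k)) := by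
    intro k
    change (leftMul 1 * actHom α k : Module.End ℂ (A ⊗[ℂ] K)) (b ⊗ₜ 1) = _
    rw [leftMul_one, one_mul, actHom_apply]
    generalize comul (R := ℂ) k = t
    induction t with
    | zero => simp; rfl
    | add x y hx hy => simp only [map_add, LinearMap.add_apply, hx, hy]; rfl
    | tmul u v => simp [diagAct_tmul]; rfl
  let X : K ⊗[ℂ] (K ⊗[ℂ] K) →ₗ[ℂ] Smash α ⊗[ℂ] K :=
    ((equivTensor α).symm.toLinearMap.rTensor K) ∘ₗ
      (TensorProduct.assoc ℂ A K K).symm.toLinearMap ∘ₗ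
      (α.toAlgHom.toLinearMap.flip b).rTensor (K ⊗[ℂ] K)
  have h1 : ∀ t : K ⊗[ℂ] K, coaction α ((equivTensor α).symm
      ((α.toAlgHom.toLinearMap.flip b).rTensor K t)) = X ((comul (R := ℂ)).lTensor K t) := by
    intro t
    induction t with
    | zero => simp
    | add x y hx hy => simp only [map_add, hx, hy]
    | tmul u v => simp [X, coaction]
  have h2 : ∀ t : K ⊗[ℂ] K,
      X (TensorProduct.assoc ℂ K K K ((comul (R := ℂ)).rTensor K t)) =
      (ofRight α).rTensor K t * (tmul α b 1 ⊗ₜ 1) := by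
    intro t
    induction t with
    | zero => simp
    | add x y hx hy => simp only [map_add, add_mul, hx, hy]
    | tmul u v =>
      rw [LinearMap.rTensor_tmul, LinearMap.rTensor_tmul, Algebra.TensorProduct.tmul_mul_tmul,
        mul_one]
      simp only [ofRight, LinearMap.comp_apply, TensorProduct.mk_apply, LinearEquiv.coe_coe,
        equivTensor_symm_tmul, h0]
      generalize comul (R := ℂ) u = s
      induction s with
      | zero => simp
      | add x y hx hy => simp only [TensorProduct.add_tmul, map_add, hx, hy]
      | tmul p q => simp [X]
  rw [h0, h1, ← Coalgebra.coassoc_apply, h2]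

theorem coaction_mul (x y : Smash α) : coaction α (x * y) = coaction α x * coaction α y := by
  induction x using induction_on with
  | zero => simp
  | add x y hx hy => simp only [add_mul, map_add, hx, hy]
  | tmul a h =>
  induction y using induction_on with
  | zero => simp
  | add x y hx hy => simp only [mul_add, map_add, hx, hy]
  | tmul b g =>
    have : tmul α a h * tmul α b g =
        tmul α a 1 * ((tmul α 1 h * tmul α b 1) * tmul α 1 g) := by
      rw [tmul_eq α a h, tmul_eq α b g]
      simp only [mul_assoc]
    rw [this, coaction_left, coaction_right, coaction_mid, coaction_tmul, coaction_tmul]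
    simp only [mul_assoc]

theorem coaction_one : coaction α 1 = 1 := by
  rw [one_def, coaction_tmul, Bialgebra.comul_one, Algebra.TensorProduct.one_def,
    LinearMap.rTensor_tmul]
  have : ofRight α 1 = 1 := rfl
  rw [this, ← one_def, ← Algebra.TensorProduct.one_def, one_mul]

variable [HopfStarAlgebra K] [StarModule ℂ A]

/-- The linear map `b ⊗ g ↦ (1 ⋊ g)(b ⋊ 1)`. -/
noncomputable def flipMul : A ⊗[ℂ] K →ₗ[ℂ] A ⊗[ℂ] K :=
  TensorProduct.lift ((actHom α).toLinearMap.flip ∘ₗ (TensorProduct.mk ℂ A K).flip 1)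

noncomputable instance : Star (Smash α) := ⟨fun x => flipMul α (star (x : A ⊗[ℂ] K))⟩

theorem star_def (x : Smash α) : star x = (flipMul α (star (x : A ⊗[ℂ] K)) : A ⊗[ℂ] K) := rfl

theorem star_tmul (a : A) (h : K) :
    star (tmul α a h) = tmul α 1 (star h) * tmul α (star a) 1 := by
  change actHom α (star h) (star a ⊗ₜ 1) =
    (leftMul 1 * actHom α (star h) : Module.End ℂ (A ⊗[ℂ] K)) (star a ⊗ₜ 1)
  rw [leftMul_one, one_mul]

theorem star_add' (x y : Smash α) : star (x + y) = star x + star y := by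
  have h := star_add (R := A ⊗[ℂ] K) x y
  exact (congrArg (flipMul α) h).trans (map_add _ _ _)

theorem star_star' (x : Smash α) : star (star x) = x := by
  induction x using induction_on with
  | zero =>
    change flipMul α (star (flipMul α (star (0 : A ⊗[ℂ] K)))) = 0
    simp
  | add x y hx hy => rw [star_add', star_add', hx, hy]
  | tmul a h =>
    change flipMul α (star (actHom α (star h) (star a ⊗ₜ 1))) = a ⊗ₜ h
    rw [actHom_apply, HopfStarAlgebra.comul_star]
    let Y : K ⊗[ℂ] (K ⊗[ℂ] K) →ₗ[ℂ] A ⊗[ℂ] K :=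
      TensorProduct.lift (LinearMap.rTensorHom K ∘ₗ α.toAlgHom.toLinearMap.flip ∘ₗ
        (α.toAlgHom.toLinearMap.flip a) ∘ₗ starAntipode K)
    have h0 : ∀ (c : A) (s : K ⊗[ℂ] K),
        diagAct α s (c ⊗ₜ 1) = (α.toAlgHom.toLinearMap.flip c).rTensor K s := by
      intro c s
      induction s with
      | zero => simp
      | add x y hx hy => simp only [map_add, LinearMap.add_apply, hx, hy]
      | tmul u v => simp [diagAct_tmul]
    have h1 : ∀ t : K ⊗[ℂ] K, flipMul α (star (diagAct α (star t) (star a ⊗ₜ 1))) =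
        Y ((comul (R := ℂ)).lTensor K t) := by
      intro t
      induction t with
      | zero => simp
      | add x y hx hy => simp only [map_add, star_add, LinearMap.add_apply, hx, hy]
      | tmul u v =>
        rw [TensorProduct.star_tmul, diagAct_tmul, TensorProduct.star_tmul, α.map_star']
        simp only [star_star, mul_one, LinearMap.lTensor_tmul]
        change actHom α v (_ ⊗ₜ 1) = _
        rw [actHom_apply, h0]
        rfl
    have h2 : ∀ t : K ⊗[ℂ] K,
        Y (TensorProduct.assoc ℂ K K K ((comul (R := ℂ)).rTensor K t)) =
        TensorProduct.mk ℂ A K a (TensorProduct.lid ℂ K ((counit (R := ℂ)).rTensor K t)) := by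
      intro t
      induction t with
      | zero => simp
      | add x y hx hy => simp only [map_add, hx, hy]
      | tmul u w =>
        have h3 : ∀ s : K ⊗[ℂ] K, Y (TensorProduct.assoc ℂ K K K (s ⊗ₜ w)) =
            α.toAlgHom (TensorProduct.lift ((LinearMap.mul ℂ K).flip.comp (starAntipode K)) s) a
              ⊗ₜ w := by
          intro s
          induction s with
          | zero => simp
          | add x y hx hy =>
            simp only [map_add, TensorProduct.add_tmul, hx, hy, LinearMap.add_apply]
          | tmul p q => simp [Y]
        rw [LinearMap.rTensor_tmul, h3, mul_starAntipode]
        simp [Module.algebraMap_end_apply, TensorProduct.smul_tmul']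
    rw [h1, ← Coalgebra.coassoc_apply, h2, Coalgebra.rTensor_counit_comul]
    simp

theorem star_smul' (r : ℂ) (x : Smash α) : star (r • x) = star r • star x := by
  have h := star_smul (A := A ⊗[ℂ] K) r x
  exact (congrArg (flipMul α) h).trans (map_smul _ _ _)

theorem star_left (a : A) (x : Smash α) :
    star (tmul α a 1 * x) = star x * tmul α (star a) 1 := by
  induction x using induction_on with
  | zero =>
    rw [mul_zero]
    have : star (0 : Smash α) = 0 := by simpa using star_smul' α 0 0
    rw [this, zero_mul]
  | add x y hx hy => rw [mul_add, star_add', star_add', hx, hy, add_mul]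
  | tmul b h =>
    rw [tmul_one_mul, star_tmul, star_tmul, star_mul, mul_assoc, tmul_one_mul]

theorem star_right (x : Smash α) (g : K) :
    star (x * tmul α 1 g) = tmul α 1 (star g) * star x := by
  induction x using induction_on with
  | zero =>
    rw [zero_mul]
    have : star (0 : Smash α) = 0 := by simpa using star_smul' α 0 0
    rw [this, mul_zero]
  | add x y hx hy => rw [add_mul, star_add', star_add', hx, hy, mul_add]
  | tmul b h =>
    rw [mul_one_tmul, star_tmul, star_tmul, star_mul, ← mul_assoc, mul_one_tmul]

theorem star_mul' (x y : Smash α) : star (x * y) = star y * star x := by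
  have h0 : star (0 : Smash α) = 0 := by simpa using star_smul' α 0 0
  induction x using induction_on with
  | zero => rw [zero_mul, h0, mul_zero]
  | add x y hx hy => rw [add_mul, star_add', star_add', hx, hy, mul_add]
  | tmul a h =>
  induction y using induction_on with
  | zero => rw [mul_zero, h0, zero_mul]
  | add x y hx hy => rw [mul_add, star_add', star_add', hx, hy, add_mul]
  | tmul b g =>
    have h3 : star (tmul α 1 h * tmul α b 1) = tmul α (star b) (star h) := by
      rw [← star_star' α (tmul α (star b) (star h)), star_tmul, star_star, star_star]
    have : tmul α a h * tmul α b g =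
        tmul α a 1 * ((tmul α 1 h * tmul α b 1) * tmul α 1 g) := by
      rw [tmul_eq α a h, tmul_eq α b g]
      simp only [mul_assoc]
    rw [this, star_left, star_right, h3, star_tmul, star_tmul, tmul_eq α (star b)]
    simp only [mul_assoc]

noncomputable instance : StarRing (Smash α) where
  star_involutive := star_star' α
  star_mul := star_mul' α
  star_add := star_add' α

instance : StarModule ℂ (Smash α) := ⟨star_smul' α⟩

/-- The inclusion `a ↦ a ⋊ 1`. -/
noncomputable def ofLeft : A →⋆ₐ[ℂ] Smash α where
  toFun a := tmul α a 1
  map_one' := rfl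
  map_mul' a b := (tmul_one_mul α a b 1).symm
  map_zero' := TensorProduct.zero_tmul _ _
  map_add' a b := TensorProduct.add_tmul a b _
  commutes' r := by
    rw [Algebra.algebraMap_eq_smul_one, Algebra.algebraMap_eq_smul_one]
    exact (TensorProduct.smul_tmul' r (1 : A) (1 : K)).symm
  map_star' a := by
    rw [star_tmul, star_one]
    exact (one_mul (tmul α (star a) 1)).symm

theorem coaction_star (x : Smash α) : coaction α (star x) = star (coaction α x) := by
  induction x using induction_on with
  | zero => simp
  | add x y hx hy => simp only [star_add, map_add, hx, hy]
  | tmul a h =>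
    have h1 : ∀ t : K ⊗[ℂ] K,
        star ((ofRight α).rTensor K t) = (ofRight α).rTensor K (star t) := by
      intro t
      induction t with
      | zero => simp
      | add x y hx hy => simp only [star_add, map_add, hx, hy]
      | tmul u v =>
        have : tmul α 1 (star u) * tmul α 1 1 = tmul α 1 (star u) := mul_one _
        simp [ofRight, star_tmul, this]
    have h2 : star (tmul α a 1) = tmul α (star a) 1 := by
      rw [star_tmul, star_one]; exact one_mul _
    rw [star_tmul, coaction_mid, coaction_tmul, star_mul, h1, HopfStarAlgebra.comul_star,
      TensorProduct.star_tmul, star_one, h2]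

/-- The coaction on `A ⋊ K` as a `*`-homomorphism. -/
noncomputable def coactionHom : Smash α →⋆ₐ[ℂ] Smash α ⊗[ℂ] K :=
  { AlgHom.ofLinearMap (coaction α) (coaction_one α) (coaction_mul α) with
    map_star' := coaction_star α }

end Smash
end Smash
/-- The antipode is involutive, `S² = id`. -/
class InvolutiveAntipode (H : Type*) [Ring H] [HopfAlgebra ℂ H] : Prop where
  antipode_antipode : ∀ x : H, antipode ℂ (antipode ℂ x) = x

/-- The co-opposite `H^cop`: the same `*`-algebra, counit and antipode, with the reversed
comultiplication `h ↦ h₂ ⊗ h₁`. -/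
def Cop (H : Type*) : Type _ := H

namespace Cop
variable (H : Type*) [Ring H] [HopfAlgebra ℂ H]

instance : Ring (Cop H) := inferInstanceAs (Ring H)
instance [StarRing H] : StarRing (Cop H) := inferInstanceAs (StarRing H)
noncomputable instance : Algebra ℂ (Cop H) := inferInstanceAs (Algebra ℂ H)

/-- The identity map `H → H^cop`, an isomorphism of algebras. -/
noncomputable def of : H ≃ₐ[ℂ] Cop H := AlgEquiv.refl

theorem antipode_flip_left [InvolutiveAntipode H] (x : H) :
    LinearMap.mul' ℂ H ((antipode ℂ).rTensor H (TensorProduct.comm ℂ H H (comul (R := ℂ) x))) =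
      algebraMap ℂ H (counit (R := ℂ) x) := by
  have h1 : ∀ t : H ⊗[ℂ] H,
      LinearMap.mul' ℂ H ((antipode ℂ).rTensor H (TensorProduct.comm ℂ H H t)) =
      antipode ℂ (LinearMap.mul' ℂ H ((antipode ℂ).rTensor H t)) := by
    intro t
    induction t with
    | zero => simp
    | add x y hx hy => simp only [map_add, hx, hy]
    | tmul u v => simp [antipode_mul_antidistrib, InvolutiveAntipode.antipode_antipode]
  rw [h1, mul_antipode_rTensor_comul_apply, Algebra.algebraMap_eq_smul_one, map_smul,
    antipode_one]

theorem antipode_flip_right [InvolutiveAntipode H] (x : H) :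
    LinearMap.mul' ℂ H ((antipode ℂ).lTensor H (TensorProduct.comm ℂ H H (comul (R := ℂ) x))) =
      algebraMap ℂ H (counit (R := ℂ) x) := by
  have h1 : ∀ t : H ⊗[ℂ] H,
      LinearMap.mul' ℂ H ((antipode ℂ).lTensor H (TensorProduct.comm ℂ H H t)) =
      antipode ℂ (LinearMap.mul' ℂ H ((antipode ℂ).lTensor H t)) := by
    intro t
    induction t with
    | zero => simp
    | add x y hx hy => simp only [map_add, hx, hy]
    | tmul u v => simp [antipode_mul_antidistrib, InvolutiveAntipode.antipode_antipode]
  rw [h1, mul_antipode_lTensor_comul_apply, Algebra.algebraMap_eq_smul_one, map_smul,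
    antipode_one]

/-- The reversed comultiplication `h ↦ h₂ ⊗ h₁`. -/
noncomputable def comulFlip : H →ₗ[ℂ] H ⊗[ℂ] H :=
  (TensorProduct.comm ℂ H H).toLinearMap ∘ₗ comul (R := ℂ)

theorem comulFlip_coassoc : TensorProduct.assoc ℂ H H H ∘ₗ (comulFlip H).rTensor H ∘ₗ comulFlip H =
    (comulFlip H).lTensor H ∘ₗ comulFlip H := by
  let F : H ⊗[ℂ] (H ⊗[ℂ] H) →ₗ[ℂ] H ⊗[ℂ] (H ⊗[ℂ] H) :=
    (TensorProduct.assoc ℂ H H H).toLinearMap ∘ₗ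
      (TensorProduct.comm ℂ H H).toLinearMap.rTensor H ∘ₗ
      (TensorProduct.comm ℂ H (H ⊗[ℂ] H)).toLinearMap
  have h1 : ∀ t : H ⊗[ℂ] H, TensorProduct.assoc ℂ H H H
      ((comulFlip H).rTensor H (TensorProduct.comm ℂ H H t)) =
      F ((comul (R := ℂ)).lTensor H t) := by
    intro t
    induction t with
    | zero => simp
    | add x y hx hy => simp only [map_add, hx, hy]
    | tmul u v => simp [F, comulFlip]
  have h2 : ∀ t : H ⊗[ℂ] H, (comulFlip H).lTensor H (TensorProduct.comm ℂ H H t) =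
      F (TensorProduct.assoc ℂ H H H ((comul (R := ℂ)).rTensor H t)) := by
    intro t
    induction t with
    | zero => simp
    | add x y hx hy => simp only [map_add, hx, hy]
    | tmul u v =>
      simp only [TensorProduct.comm_tmul, LinearMap.lTensor_tmul, LinearMap.rTensor_tmul,
        comulFlip, LinearMap.comp_apply]
      generalize comul (R := ℂ) u = s
      induction s with
      | zero => simp
      | add x y hx hy => simp only [TensorProduct.add_tmul, TensorProduct.tmul_add, map_add, hx, hy]
      | tmul p q => simp [F]
  ext x
  change TensorProduct.assoc ℂ H H H
    ((comulFlip H).rTensor H (TensorProduct.comm ℂ H H (comul (R := ℂ) x))) =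
    (comulFlip H).lTensor H (TensorProduct.comm ℂ H H (comul (R := ℂ) x))
  rw [h1, h2, Coalgebra.coassoc_apply]

theorem comulFlip_rTensor_counit : (counit (R := ℂ)).rTensor H ∘ₗ comulFlip H =
    TensorProduct.mk ℂ ℂ H 1 := by
  have h1 : ∀ t : H ⊗[ℂ] H, (counit (R := ℂ)).rTensor H (TensorProduct.comm ℂ H H t) =
      TensorProduct.comm ℂ H ℂ ((counit (R := ℂ)).lTensor H t) := by
    intro t
    induction t with
    | zero => simp
    | add x y hx hy => simp only [map_add, hx, hy]
    | tmul u v => simp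
  ext x
  change (counit (R := ℂ)).rTensor H (TensorProduct.comm ℂ H H (comul (R := ℂ) x)) = _
  rw [h1, Coalgebra.lTensor_counit_comul]
  rfl

theorem comulFlip_lTensor_counit : (counit (R := ℂ)).lTensor H ∘ₗ comulFlip H =
    (TensorProduct.mk ℂ H ℂ).flip 1 := by
  have h1 : ∀ t : H ⊗[ℂ] H, (counit (R := ℂ)).lTensor H (TensorProduct.comm ℂ H H t) =
      TensorProduct.comm ℂ ℂ H ((counit (R := ℂ)).rTensor H t) := by
    intro t
    induction t with
    | zero => simp
    | add x y hx hy => simp only [map_add, hx, hy]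
    | tmul u v => simp
  ext x
  change (counit (R := ℂ)).lTensor H (TensorProduct.comm ℂ H H (comul (R := ℂ) x)) = _
  rw [h1, Coalgebra.rTensor_counit_comul]
  rfl

theorem comulFlip_mul (x y : H) : comulFlip H (x * y) = comulFlip H x * comulFlip H y := by
  change Algebra.TensorProduct.comm ℂ H H _ =
    Algebra.TensorProduct.comm ℂ H H _ * Algebra.TensorProduct.comm ℂ H H _
  rw [Bialgebra.comul_mul, map_mul]

theorem comulFlip_one : comulFlip H 1 = 1 := by
  change Algebra.TensorProduct.comm ℂ H H _ = _
  rw [Bialgebra.comul_one, map_one]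

noncomputable instance : Coalgebra ℂ (Cop H) where
  comul := (comulFlip H : H →ₗ[ℂ] H ⊗[ℂ] H)
  counit := (counit (R := ℂ) : H →ₗ[ℂ] ℂ)
  coassoc := comulFlip_coassoc H
  rTensor_counit_comp_comul := comulFlip_rTensor_counit H
  lTensor_counit_comp_comul := comulFlip_lTensor_counit H

noncomputable instance : Bialgebra ℂ (Cop H) :=
  Bialgebra.mk' ℂ (Cop H) (Bialgebra.counit_one (R := ℂ) (A := H))
    (fun {a b} => Bialgebra.counit_mul (R := ℂ) (A := H) a b) (comulFlip_one H)
    (fun {a b} => comulFlip_mul H a b)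

noncomputable instance [InvolutiveAntipode H] : HopfAlgebra ℂ (Cop H) where
  antipode := (antipode ℂ : H →ₗ[ℂ] H)
  mul_antipode_rTensor_comul := LinearMap.ext (antipode_flip_left H)
  mul_antipode_lTensor_comul := LinearMap.ext (antipode_flip_right H)

instance [StarRing H] [HopfStarAlgebra H] [InvolutiveAntipode H] : HopfStarAlgebra (Cop H) where
  star_smul r x := star_smul (A := H) r x
  comul_star x := by
    have h1 : ∀ t : H ⊗[ℂ] H, TensorProduct.comm ℂ H H (star t) =
        star (TensorProduct.comm ℂ H H t) := by
      intro t
      induction t with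
      | zero => simp
      | add x y hx hy => simp only [map_add, star_add, hx, hy]
      | tmul u v => simp
    exact (congrArg (TensorProduct.comm ℂ H H) (HopfStarAlgebra.comul_star (H := H) x)).trans (h1 _)
  star_antipode_star_antipode x := HopfStarAlgebra.star_antipode_star_antipode (H := H) x

end Cop

/-- A right coaction `β : B → B ⊗ H`, `b ↦ b₀ ⊗ b₁`, making `B` a right `H`-comodule
`*`-algebra. -/
structure Coaction (B H : Type*) [Ring B] [StarRing B] [Algebra ℂ B] [StarModule ℂ B]
    [Ring H] [StarRing H] [HopfAlgebra ℂ H] [HopfStarAlgebra H] where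
  toStarAlgHom : B →⋆ₐ[ℂ] B ⊗[ℂ] H
  coassoc : ∀ b : B, TensorProduct.assoc ℂ B H H
      (toStarAlgHom.toAlgHom.toLinearMap.rTensor H (toStarAlgHom b)) =
    (comul (R := ℂ)).lTensor B (toStarAlgHom b)
  lTensor_counit : ∀ b : B, (counit (R := ℂ)).lTensor B (toStarAlgHom b) = b ⊗ₜ[ℂ] 1

section Invariants

set_option linter.unusedSectionVars false

variable {H A B : Type*} [Ring H] [StarRing H] [HopfAlgebra ℂ H] [HopfStarAlgebra H]
  [InvolutiveAntipode H] [Ring A] [StarRing A] [Algebra ℂ A] [StarModule ℂ A]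
  [Ring B] [StarRing B] [Algebra ℂ B] [StarModule ℂ B]

variable (β : Coaction B H) (α : HopfAction (Cop H) A)

/-- The map `x ⊗ k ↦ k S(x)`. -/
noncomputable def twist : H ⊗[ℂ] Cop H →ₗ[ℂ] Cop H :=
  TensorProduct.lift
    ((LinearMap.mul ℂ (Cop H)).flip ∘ₗ (Cop.of H).toLinearMap ∘ₗ antipode ℂ)

/-- The product coaction `β ⊙ π` of `H^cop` on `B ⊗ (A ⋊ H^cop)`:
`b ⊗ (a ⋊ h) ↦ b₀ ⊗ (a ⋊ h₂) ⊗ h₁ S(b₁)`, the Sweedler indices of `h` being those of `H`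
(so that `π(a ⋊ h) = (a ⋊ h₂) ⊗ h₁`). -/
noncomputable def prodCoaction :
    B ⊗[ℂ] Smash α →ₗ[ℂ] (B ⊗[ℂ] Smash α) ⊗[ℂ] Cop H :=
  (twist (H := H)).lTensor (B ⊗[ℂ] Smash α) ∘ₗ
    (TensorProduct.tensorTensorTensorComm ℂ B H (Smash α) (Cop H)).toLinearMap ∘ₗ
    TensorProduct.map β.toStarAlgHom.toAlgHom.toLinearMap (Smash.coaction α)

namespace Invariants

/-- The map `b ⊗ s ↦ b ⊗ π(s)`. -/
noncomputable def homRight : B ⊗[ℂ] Smash α →ₐ[ℂ] B ⊗[ℂ] (Smash α ⊗[ℂ] Cop H) :=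
  Algebra.TensorProduct.map (AlgHom.id ℂ B) (Smash.coactionHom α).toAlgHom

/-- The map `b ⊗ s ↦ b₀ ⊗ s ⊗ b₁`. -/
noncomputable def homLeft : B ⊗[ℂ] Smash α →ₐ[ℂ] B ⊗[ℂ] (Smash α ⊗[ℂ] Cop H) :=
  ((Algebra.TensorProduct.map (AlgHom.id ℂ B)
    (Algebra.TensorProduct.comm ℂ (Cop H) (Smash α)).toAlgHom).comp
    (Algebra.TensorProduct.assoc ℂ ℂ ℂ B (Cop H) (Smash α)).toAlgHom).comp
    (Algebra.TensorProduct.map ((Algebra.TensorProduct.map (AlgHom.id ℂ B)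
      (Cop.of H).toAlgHom).comp β.toStarAlgHom.toAlgHom) (AlgHom.id ℂ (Smash α)))

theorem homRight_star (x : B ⊗[ℂ] Smash α) : homRight α (star x) = star (homRight α x) := by
  induction x with
  | zero => simp
  | add x y hx hy => simp only [star_add, map_add, hx, hy]
  | tmul b s =>
    simp [homRight]
    congr 1
    exact Smash.coaction_star α s

theorem homLeft_tmul (b : B) (s : Smash α) : homLeft β α (b ⊗ₜ s) =
    TensorProduct.lift ((TensorProduct.mk ℂ B (Smash α ⊗[ℂ] Cop H)).compl₂
      (TensorProduct.mk ℂ (Smash α) (Cop H) s ∘ₗ (Cop.of H).toLinearMap)) (β.toStarAlgHom b) := by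
  simp only [homLeft, AlgHom.comp_apply, Algebra.TensorProduct.map_tmul]
  change _ = TensorProduct.lift _ (β.toStarAlgHom.toAlgHom b)
  generalize β.toStarAlgHom.toAlgHom b = t
  induction t with
  | zero => simp
  | add x y hx hy => simp only [TensorProduct.add_tmul, map_add, hx, hy]
  | tmul u v => simp

theorem homLeft_star (x : B ⊗[ℂ] Smash α) : homLeft β α (star x) = star (homLeft β α x) := by
  induction x with
  | zero => simp
  | add x y hx hy => simp only [star_add, map_add, hx, hy]
  | tmul b s =>
    rw [TensorProduct.star_tmul, homLeft_tmul, homLeft_tmul, map_star β.toStarAlgHom b]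
    generalize β.toStarAlgHom b = t
    induction t with
    | zero => simp
    | add x y hx hy => simp only [star_add, map_add, hx, hy]
    | tmul u v => simp; rfl

/-- The map `b ⊗ s ⊗ k ↦ b₀ ⊗ s ⊗ k f(b₁)`. -/
noncomputable def tw (f : H →ₗ[ℂ] H) :
    B ⊗[ℂ] (Smash α ⊗[ℂ] Cop H) →ₗ[ℂ] B ⊗[ℂ] (Smash α ⊗[ℂ] Cop H) :=
  (TensorProduct.lift (LinearMap.lTensorHom (Smash α) ∘ₗ (LinearMap.mul ℂ (Cop H)).flip ∘ₗ
      (Cop.of H).toLinearMap ∘ₗ f)).lTensor B ∘ₗ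
    (TensorProduct.assoc ℂ B H (Smash α ⊗[ℂ] Cop H)).toLinearMap ∘ₗ
    β.toStarAlgHom.toAlgHom.toLinearMap.rTensor (Smash α ⊗[ℂ] Cop H)

theorem assoc_prodCoaction (x : B ⊗[ℂ] Smash α) :
    TensorProduct.assoc ℂ B (Smash α) (Cop H) (prodCoaction β α x) =
      tw β α (antipode ℂ) (homRight α x) := by
  induction x with
  | zero => simp
  | add x y hx hy => simp only [map_add, hx, hy]
  | tmul b s =>
    have h1 : homRight α (b ⊗ₜ[ℂ] s) = b ⊗ₜ Smash.coaction α s := rfl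
    rw [h1]
    simp only [prodCoaction, tw, LinearMap.comp_apply, TensorProduct.map_tmul,
      LinearMap.rTensor_tmul]
    generalize Smash.coaction α s = p
    generalize β.toStarAlgHom.toAlgHom.toLinearMap b = t
    induction t with
    | zero => simp
    | add x y hx hy => simp only [TensorProduct.add_tmul, map_add, hx, hy]
    | tmul u v =>
    induction p with
    | zero => simp
    | add x y hx hy => simp only [TensorProduct.tmul_add, map_add, hx, hy]
    | tmul c d => simp [twist]

/-- Cancellation of two twists. -/
theorem tw_tw (f g : H →ₗ[ℂ] H)
    (hfg : ∀ x : H, TensorProduct.lift ((LinearMap.mul ℂ H).flip.compl₁₂ f g)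
      (comul (R := ℂ) x) = algebraMap ℂ H (counit (R := ℂ) x))
    (y : B ⊗[ℂ] (Smash α ⊗[ℂ] Cop H)) : tw β α f (tw β α g y) = y := by
  induction y with
  | zero => simp
  | add x y hx hy => simp only [map_add, hx, hy]
  | tmul b p =>
  induction p with
  | zero => simp
  | add x y hx hy => simp only [TensorProduct.tmul_add, map_add, hx, hy]
  | tmul s k =>
    let W : B ⊗[ℂ] (H ⊗[ℂ] H) →ₗ[ℂ] B ⊗[ℂ] (Smash α ⊗[ℂ] Cop H) :=
      (TensorProduct.mk ℂ (Smash α) (Cop H) s ∘ₗ LinearMap.mulLeft ℂ k ∘ₗ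
        (Cop.of H).toLinearMap ∘ₗ
        TensorProduct.lift ((LinearMap.mul ℂ H).flip.compl₁₂ f g)).lTensor B
    have h1 : ∀ t : B ⊗[ℂ] H, tw β α f
        ((TensorProduct.lift (LinearMap.lTensorHom (Smash α) ∘ₗ
          (LinearMap.mul ℂ (Cop H)).flip ∘ₗ (Cop.of H).toLinearMap ∘ₗ g)).lTensor B
        (TensorProduct.assoc ℂ B H (Smash α ⊗[ℂ] Cop H) (t ⊗ₜ (s ⊗ₜ k)))) =
        W (TensorProduct.assoc ℂ B H H
          (β.toStarAlgHom.toAlgHom.toLinearMap.rTensor H t)) := by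
      intro t
      induction t with
      | zero => simp
      | add x y hx hy => simp only [TensorProduct.add_tmul, map_add, hx, hy]
      | tmul u v =>
        simp only [tw, LinearMap.comp_apply, LinearMap.rTensor_tmul, LinearEquiv.coe_coe,
          TensorProduct.assoc_tmul, LinearMap.lTensor_tmul, TensorProduct.lift.tmul]
        generalize β.toStarAlgHom.toAlgHom.toLinearMap u = r
        induction r with
        | zero => simp
        | add x y hx hy => simp only [TensorProduct.add_tmul, map_add, hx, hy]
        | tmul p q => simp [W, mul_assoc]
    have h2 : ∀ t : B ⊗[ℂ] H, W ((comul (R := ℂ)).lTensor B t) =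
        (TensorProduct.rid ℂ B ((counit (R := ℂ)).lTensor B t)) ⊗ₜ (s ⊗ₜ k) := by
      intro t
      induction t with
      | zero => simp
      | add x y hx hy => simp only [TensorProduct.add_tmul, map_add, hx, hy]
      | tmul u v =>
        simp only [W, LinearMap.lTensor_tmul, LinearMap.comp_apply, hfg]
        simp [Algebra.algebraMap_eq_smul_one, TensorProduct.smul_tmul]
    have h3 : tw β α g (b ⊗ₜ (s ⊗ₜ k)) = (TensorProduct.lift (LinearMap.lTensorHom (Smash α) ∘ₗ
          (LinearMap.mul ℂ (Cop H)).flip ∘ₗ (Cop.of H).toLinearMap ∘ₗ g)).lTensor B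
        (TensorProduct.assoc ℂ B H (Smash α ⊗[ℂ] Cop H)
          (β.toStarAlgHom b ⊗ₜ (s ⊗ₜ k))) := rfl
    rw [h3, h1, β.coassoc, h2, β.lTensor_counit]
    simp

theorem tw_one_tmul (x : B ⊗[ℂ] Smash α) :
    tw β α LinearMap.id (TensorProduct.assoc ℂ B (Smash α) (Cop H) (x ⊗ₜ 1)) =
      homLeft β α x := by
  induction x with
  | zero => simp
  | add x y hx hy => simp only [TensorProduct.add_tmul, map_add, hx, hy]
  | tmul b s =>
    rw [homLeft_tmul]
    simp only [tw, LinearMap.comp_apply, LinearEquiv.coe_coe, TensorProduct.assoc_tmul,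
      LinearMap.rTensor_tmul]
    change _ = TensorProduct.lift _ (β.toStarAlgHom.toAlgHom.toLinearMap b)
    generalize β.toStarAlgHom.toAlgHom.toLinearMap b = t
    induction t with
    | zero => simp
    | add x y hx hy => simp only [TensorProduct.add_tmul, map_add, hx, hy]
    | tmul u v => simp

theorem prodCoaction_eq_iff (x : B ⊗[ℂ] Smash α) :
    prodCoaction β α x = x ⊗ₜ 1 ↔ homRight α x = homLeft β α x := by
  have hf : ∀ x : H, TensorProduct.lift ((LinearMap.mul ℂ H).flip.compl₁₂ LinearMap.id
      (antipode ℂ)) (comul (R := ℂ) x) = algebraMap ℂ H (counit (R := ℂ) x) := by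
    intro x
    rw [← Cop.antipode_flip_left]
    generalize comul (R := ℂ) x = t
    induction t with
    | zero => simp
    | add x y hx hy => simp only [map_add, hx, hy]
    | tmul u v => simp
  have hg : ∀ x : H, TensorProduct.lift ((LinearMap.mul ℂ H).flip.compl₁₂ (antipode ℂ)
      LinearMap.id) (comul (R := ℂ) x) = algebraMap ℂ H (counit (R := ℂ) x) := by
    intro x
    rw [← Cop.antipode_flip_right]
    generalize comul (R := ℂ) x = t
    induction t with
    | zero => simp
    | add x y hx hy => simp only [map_add, hx, hy]
    | tmul u v => simp
  rw [← (TensorProduct.assoc ℂ B (Smash α) (Cop H)).injective.eq_iff, assoc_prodCoaction]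
  constructor
  · intro h
    have := congrArg (tw β α LinearMap.id) h
    rwa [tw_tw β α _ _ hf, tw_one_tmul] at this
  · intro h
    rw [h, ← tw_one_tmul, tw_tw β α _ _ hg]

end Invariants

/-- The `*`-algebra `(B ⊗ A ⋊ H^cop)^{H^cop}` of the invariants of `β ⊙ π`, that is, of the `x`
with `(β ⊙ π)(x) = x ⊗ 1`. -/
noncomputable def invariants : StarSubalgebra ℂ (B ⊗[ℂ] Smash α) where
  carrier := {x | prodCoaction β α x = x ⊗ₜ[ℂ] 1}
  mul_mem' {x y} hx hy := by
    simp only [Set.mem_ofPred_eq, Invariants.prodCoaction_eq_iff] at *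
    rw [map_mul, map_mul, hx, hy]
  one_mem' := by
    simp only [Set.mem_ofPred_eq, Invariants.prodCoaction_eq_iff]
    exact (map_one (Invariants.homRight α)).trans (map_one (Invariants.homLeft β α)).symm
  add_mem' {x y} hx hy := by
    simp only [Set.mem_ofPred_eq, Invariants.prodCoaction_eq_iff] at *
    rw [map_add, map_add, hx, hy]
  zero_mem' := by
    simp only [Set.mem_ofPred_eq, Invariants.prodCoaction_eq_iff, map_zero]
  algebraMap_mem' r := by
    simp only [Set.mem_ofPred_eq, Invariants.prodCoaction_eq_iff, AlgHom.commutes]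
  star_mem' {x} hx := by
    simp only [Set.mem_ofPred_eq, Invariants.prodCoaction_eq_iff] at *
    rw [Invariants.homRight_star, Invariants.homLeft_star, hx]

theorem one_tmul_ofLeft_mem (a : A) :
    (1 : B) ⊗ₜ[ℂ] Smash.ofLeft α a ∈ invariants β α := by
  change prodCoaction β α _ = _
  rw [Invariants.prodCoaction_eq_iff, Invariants.homLeft_tmul, map_one]
  have h1 : Smash.coaction α (Smash.ofLeft α a) = Smash.ofLeft α a ⊗ₜ 1 := by
    change Smash.coaction α (Smash.tmul α a 1) = Smash.tmul α a 1 ⊗ₜ 1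
    rw [Smash.coaction_tmul, Bialgebra.comul_one, Algebra.TensorProduct.one_def,
      LinearMap.rTensor_tmul, Algebra.TensorProduct.tmul_mul_tmul]
    change (Smash.tmul α a 1 * 1) ⊗ₜ _ = _
    rw [mul_one, mul_one]
  change (1 : B) ⊗ₜ[ℂ] Smash.coaction α (Smash.ofLeft α a) = _
  rw [h1, Algebra.TensorProduct.one_def]
  simp

/-- The inclusion `A ⊂ (B ⊗ A ⋊ H^cop)^{H^cop}`, `a ↦ 1 ⊗ a ⋊ 1`. -/
noncomputable def inclusion : A →⋆ₐ[ℂ] invariants β α where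
  toFun a := ⟨(1 : B) ⊗ₜ[ℂ] Smash.ofLeft α a, one_tmul_ofLeft_mem β α a⟩
  map_one' := Subtype.ext (by simp [Algebra.TensorProduct.one_def])
  map_mul' a b := Subtype.ext (by simp)
  map_zero' := Subtype.ext (by simp)
  map_add' a b := Subtype.ext (by simp [TensorProduct.tmul_add])
  commutes' r := Subtype.ext (by
    simp [Algebra.algebraMap_eq_smul_one, Algebra.TensorProduct.one_def])
  map_star' a := Subtype.ext (by simp [map_star])

end Invariants

/-- `τ` is a faithful Haar state on the Hopf `*`-algebra `H`: unital, left and right invariant, and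
`τ(h^* h) > 0` for `h ≠ 0`. A Hopf `*`-algebra is a compact quantum group algebra (it is spanned by
the coefficients of its finite-dimensional unitary corepresentations) if and only if it has such
a functional, which is then unique. -/
structure IsHaarState {H : Type*} [Ring H] [StarRing H] [HopfAlgebra ℂ H]
    (τ : H →ₗ[ℂ] ℂ) : Prop where
  map_one : τ 1 = 1
  left_invariant : ∀ h : H,
    TensorProduct.rid ℂ H (τ.lTensor H (comul (R := ℂ) h)) = τ h • (1 : H)
  right_invariant : ∀ h : H,
    TensorProduct.lid ℂ H (τ.rTensor H (comul (R := ℂ) h)) = τ h • (1 : H)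
  pos : ∀ h : H, h ≠ 0 → ∃ r : ℝ, 0 < r ∧ τ (star h * h) = r

/-- The dual of `H^cop`, as a space of functionals on `H`: those of the form `x ↦ τ(x S(h))`. -/
def dualCop {H : Type*} [Ring H] [HopfAlgebra ℂ H] (τ : H →ₗ[ℂ] ℂ) : Set (H →ₗ[ℂ] ℂ) :=
  {ω | ∃ h : H, ∀ x : H, ω x = τ (x * antipode ℂ h)}

namespace Coaction
variable {B H : Type*} [Ring B] [StarRing B] [Algebra ℂ B] [StarModule ℂ B]
  [Ring H] [StarRing H] [HopfAlgebra ℂ H] [HopfStarAlgebra H]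

/-- The action `Λ(ω) b = b₀ ω(b₁)` of functionals on a comodule algebra. -/
noncomputable def dualAction (β : Coaction B H) (ω : H →ₗ[ℂ] ℂ) : Module.End ℂ B :=
  (TensorProduct.rid ℂ B).toLinearMap ∘ₗ ω.lTensor B ∘ₗ
    β.toStarAlgHom.toAlgHom.toLinearMap

end Coaction

namespace HopfAction
variable {Q M : Type*} [Ring Q] [StarRing Q] [HopfAlgebra ℂ Q]
    [Ring M] [StarRing M] [Algebra ℂ M]

/-- The subalgebra `ι(N)` is contained in the invariants `M^Q = {m | q · m = ε(q) m for all q}`. -/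
def Fixes (ρ : HopfAction Q M) {N : Type*} [Ring N] [StarRing N] [Algebra ℂ N]
    (ι : N →⋆ₐ[ℂ] M) : Prop :=
  ∀ (q : Q) (n : N), ρ.toAlgHom q (ι n) = counit (R := ℂ) q • ι n

/-- The action of `Q` on `M` is outer: `M' ∩ (M ⋊ Q) = ℂ 1`. -/
def IsOuter (ρ : HopfAction Q M) : Prop :=
  ∀ x : Smash ρ, (∀ a : M, Smash.tmul ρ a 1 * x = x * Smash.tmul ρ a 1) →
    ∃ c : ℂ, x = c • (1 : Smash ρ)

end HopfAction

/-- A Hopf `*`-subalgebra: a unital `*`-subalgebra `K` with `Δ(K) ⊆ K ⊗ K` and `S(K) ⊆ K`.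
It is a Hopf `*`-algebra with the restricted structure, see the instances below. -/
structure HopfStarSubalgebra (Q : Type*) [Ring Q] [StarRing Q] [HopfAlgebra ℂ Q]
    [HopfStarAlgebra Q] extends StarSubalgebra ℂ Q where
  comul_mem' : ∀ x ∈ carrier, comul (R := ℂ) x ∈ LinearMap.range (TensorProduct.map
    toStarSubalgebra.toSubalgebra.toSubmodule.subtype
    toStarSubalgebra.toSubalgebra.toSubmodule.subtype)
  antipode_mem' : ∀ x ∈ carrier, antipode ℂ x ∈ carrier

namespace HopfStarSubalgebra

variable {Q : Type*} [Ring Q] [StarRing Q] [HopfAlgebra ℂ Q] [HopfStarAlgebra Q]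
  (K : HopfStarSubalgebra Q)

def incl : K.toStarSubalgebra →ₗ[ℂ] Q :=
  K.toStarSubalgebra.toSubalgebra.toSubmodule.subtype

theorem incl_apply (x : K.toStarSubalgebra) : K.incl x = x := rfl

theorem incl_injective : Function.Injective K.incl := Subtype.val_injective

theorem map_incl_injective : Function.Injective (TensorProduct.map K.incl K.incl) :=
  TensorProduct.map_injective_of_flat_flat _ _ K.incl_injective K.incl_injective

noncomputable def subComul : K.toStarSubalgebra →ₗ[ℂ] K.toStarSubalgebra ⊗[ℂ] K.toStarSubalgebra :=
  (LinearEquiv.ofInjective _ K.map_incl_injective).symm.toLinearMap ∘ₗ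
    (comul (R := ℂ) ∘ₗ K.incl).codRestrict (LinearMap.range (TensorProduct.map K.incl K.incl))
      fun x => K.comul_mem' x x.2

theorem map_incl_subComul (x : K.toStarSubalgebra) :
    TensorProduct.map K.incl K.incl (K.subComul x) = comul (R := ℂ) (x : Q) :=
  congrArg Subtype.val ((LinearEquiv.ofInjective _ K.map_incl_injective).apply_symm_apply
    ⟨comul (R := ℂ) (x : Q), K.comul_mem' x x.2⟩)

noncomputable instance : Coalgebra ℂ K.toStarSubalgebra where
  comul := K.subComul
  counit := counit (R := ℂ) ∘ₗ K.incl
  coassoc := by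
    have hinj : Function.Injective
        (TensorProduct.map K.incl (TensorProduct.map K.incl K.incl)) :=
      TensorProduct.map_injective_of_flat_flat _ _ K.incl_injective K.map_incl_injective
    have h1 : ∀ t : K.toStarSubalgebra ⊗[ℂ] K.toStarSubalgebra,
        TensorProduct.map K.incl (TensorProduct.map K.incl K.incl)
          (TensorProduct.assoc ℂ _ _ _ (K.subComul.rTensor _ t)) =
        TensorProduct.assoc ℂ Q Q Q ((comul (R := ℂ)).rTensor Q
          (TensorProduct.map K.incl K.incl t)) := by
      intro t
      induction t with
      | zero => simp
      | add x y hx hy => simp only [map_add, hx, hy]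
      | tmul u v =>
        simp only [LinearMap.rTensor_tmul, TensorProduct.map_tmul, incl_apply,
          ← map_incl_subComul]
        generalize K.subComul u = s
        induction s with
        | zero => simp
        | add x y hx hy => simp only [TensorProduct.add_tmul, map_add, hx, hy]
        | tmul p q => simp [incl_apply]
    have h2 : ∀ t : K.toStarSubalgebra ⊗[ℂ] K.toStarSubalgebra,
        TensorProduct.map K.incl (TensorProduct.map K.incl K.incl) (K.subComul.lTensor _ t) =
        (comul (R := ℂ)).lTensor Q (TensorProduct.map K.incl K.incl t) := by
      intro t
      induction t with
      | zero => simp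
      | add x y hx hy => simp only [map_add, hx, hy]
      | tmul u v => simp [map_incl_subComul, incl_apply]
    apply LinearMap.ext
    intro x
    apply hinj
    simp only [LinearMap.comp_apply, LinearEquiv.coe_coe]
    rw [h1, h2, map_incl_subComul, Coalgebra.coassoc_apply]
  rTensor_counit_comp_comul := by
    have h1 : ∀ t : K.toStarSubalgebra ⊗[ℂ] K.toStarSubalgebra,
        K.incl.lTensor ℂ ((counit (R := ℂ) ∘ₗ K.incl).rTensor _ t) =
        (counit (R := ℂ)).rTensor Q (TensorProduct.map K.incl K.incl t) := by
      intro t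
      induction t with
      | zero => simp
      | add x y hx hy => simp only [map_add, hx, hy]
      | tmul u v => simp
    apply LinearMap.ext
    intro x
    apply Module.Flat.lTensor_preserves_injective_linearMap (M := ℂ) _ K.incl_injective
    simp only [LinearMap.comp_apply]
    rw [h1, map_incl_subComul, Coalgebra.rTensor_counit_comul]
    rfl
  lTensor_counit_comp_comul := by
    have h1 : ∀ t : K.toStarSubalgebra ⊗[ℂ] K.toStarSubalgebra,
        K.incl.rTensor ℂ ((counit (R := ℂ) ∘ₗ K.incl).lTensor _ t) =
        (counit (R := ℂ)).lTensor Q (TensorProduct.map K.incl K.incl t) := by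
      intro t
      induction t with
      | zero => simp
      | add x y hx hy => simp only [map_add, hx, hy]
      | tmul u v => simp
    apply LinearMap.ext
    intro x
    apply Module.Flat.rTensor_preserves_injective_linearMap (M := ℂ) _ K.incl_injective
    simp only [LinearMap.comp_apply]
    rw [h1, map_incl_subComul, Coalgebra.lTensor_counit_comul]
    rfl

theorem map_incl_mul (s t : K.toStarSubalgebra ⊗[ℂ] K.toStarSubalgebra) :
    TensorProduct.map K.incl K.incl (s * t) =
      TensorProduct.map K.incl K.incl s * TensorProduct.map K.incl K.incl t := by
  induction s with
  | zero => simp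
  | add x y hx hy => simp only [add_mul, map_add, hx, hy]
  | tmul u v =>
  induction t with
  | zero => simp
  | add x y hx hy => simp only [mul_add, map_add, hx, hy]
  | tmul u' v' => simp [incl_apply]

theorem map_incl_comul (x : K.toStarSubalgebra) :
    TensorProduct.map K.incl K.incl (comul (R := ℂ) x) = comul (R := ℂ) (x : Q) :=
  K.map_incl_subComul x

noncomputable instance : Bialgebra ℂ K.toStarSubalgebra :=
  Bialgebra.mk' ℂ K.toStarSubalgebra
    (Bialgebra.counit_one (R := ℂ) (A := Q))
    (fun {a b} => Bialgebra.counit_mul (R := ℂ) (A := Q) a b)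
    (by
      apply K.map_incl_injective
      rw [map_incl_comul]
      simp [Algebra.TensorProduct.one_def, incl_apply])
    (fun {a b} => by
      apply K.map_incl_injective
      rw [map_incl_comul, map_incl_mul, map_incl_comul, map_incl_comul]
      exact Bialgebra.comul_mul (R := ℂ) (A := Q) a b)

def subAntipode : K.toStarSubalgebra →ₗ[ℂ] K.toStarSubalgebra where
  toFun x := ⟨antipode ℂ (x : Q), K.antipode_mem' x x.2⟩
  map_add' x y := Subtype.ext (by simp)
  map_smul' r x := Subtype.ext (by simp)

noncomputable instance : HopfAlgebra ℂ K.toStarSubalgebra where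
  antipode := K.subAntipode
  mul_antipode_rTensor_comul := by
    have h1 : ∀ t : K.toStarSubalgebra ⊗[ℂ] K.toStarSubalgebra,
        K.incl (LinearMap.mul' ℂ _ (K.subAntipode.rTensor _ t)) =
        LinearMap.mul' ℂ Q ((antipode ℂ).rTensor Q (TensorProduct.map K.incl K.incl t)) := by
      intro t
      induction t with
      | zero => simp
      | add x y hx hy => simp only [map_add, hx, hy]
      | tmul u v => simp [incl_apply, subAntipode]
    apply LinearMap.ext
    intro x
    apply K.incl_injective
    simp only [LinearMap.comp_apply]
    rw [h1, map_incl_comul, mul_antipode_rTensor_comul_apply]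
    rfl
  mul_antipode_lTensor_comul := by
    have h1 : ∀ t : K.toStarSubalgebra ⊗[ℂ] K.toStarSubalgebra,
        K.incl (LinearMap.mul' ℂ _ (K.subAntipode.lTensor _ t)) =
        LinearMap.mul' ℂ Q ((antipode ℂ).lTensor Q (TensorProduct.map K.incl K.incl t)) := by
      intro t
      induction t with
      | zero => simp
      | add x y hx hy => simp only [map_add, hx, hy]
      | tmul u v => simp [incl_apply, subAntipode]
    apply LinearMap.ext
    intro x
    apply K.incl_injective
    simp only [LinearMap.comp_apply]
    rw [h1, map_incl_comul, mul_antipode_lTensor_comul_apply]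
    rfl

instance : HopfStarAlgebra K.toStarSubalgebra where
  comul_star x := by
    have h1 : ∀ t : K.toStarSubalgebra ⊗[ℂ] K.toStarSubalgebra,
        TensorProduct.map K.incl K.incl (star t) = star (TensorProduct.map K.incl K.incl t) := by
      intro t
      induction t with
      | zero => simp
      | add x y hx hy => simp only [star_add, map_add, hx, hy]
      | tmul u v => simp [incl_apply]
    apply K.map_incl_injective
    rw [h1, map_incl_comul, map_incl_comul]
    exact HopfStarAlgebra.comul_star (x : Q)
  star_antipode_star_antipode x :=
    Subtype.ext (HopfStarAlgebra.star_antipode_star_antipode (x : Q))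

end HopfStarSubalgebra

/-- `K` is the Hopf centralizer in `Q` of the set `S` of operators on `B`, where `Q` acts on `B`:
the largest Hopf `*`-subalgebra of `Q` all of whose elements act by operators commuting with
every element of `S`. -/
structure IsHopfCentralizer {Q B : Type*} [Ring Q] [StarRing Q] [HopfAlgebra ℂ Q]
    [HopfStarAlgebra Q] [Ring B] [StarRing B] [Algebra ℂ B] (ρ : HopfAction Q B)
    (S : Set (Module.End ℂ B)) (K : HopfStarSubalgebra Q) : Prop where
  commute : ∀ q ∈ K.toStarSubalgebra, ∀ T ∈ S, ρ.toAlgHom q * T = T * ρ.toAlgHom q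
  largest : ∀ L : HopfStarSubalgebra Q,
    (∀ q ∈ L.toStarSubalgebra, ∀ T ∈ S, ρ.toAlgHom q * T = T * ρ.toAlgHom q) →
      L.toStarSubalgebra ≤ K.toStarSubalgebra

/-- `Q` with its action `ρ` on `M` is the quantum Galois group of `ι : N → M`: a terminal object in
the category whose objects are the Hopf `*`-algebras acting on `M` (as module `*`-algebra) with
`N` contained in the invariants and whose morphisms are the Hopf `*`-algebra homomorphisms
intertwining the actions. (A bialgebra homomorphism between Hopf algebras automatically
preserves antipodes.) -/
structure IsQuantumGaloisGroup {N M : Type*} [Ring N] [StarRing N] [Algebra ℂ N]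
    [Ring M] [StarRing M] [Algebra ℂ M] (ι : N →⋆ₐ[ℂ] M)
    (Q : Type w) [Ring Q] [StarRing Q] [HopfAlgebra ℂ Q] [HopfStarAlgebra Q]
    (ρ : HopfAction Q M) : Prop where
  fixes : ρ.Fixes ι
  terminal : ∀ (Q' : Type w) [Ring Q'] [StarRing Q'] [HopfAlgebra ℂ Q'] [HopfStarAlgebra Q']
    (ρ' : HopfAction Q' M), ρ'.Fixes ι →
    ∃! φ : Q' →ₐc[ℂ] Q, (∀ x, φ (star x) = star (φ x)) ∧
      ∀ (q : Q') (m : M), ρ.toAlgHom (φ q) m = ρ'.toAlgHom q m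

/-- `Q` with its action `ρ` on `B` is the quantum automorphism group of `B`: the universal
Hopf `*`-algebra acting on `B`, that is, the quantum Galois group of `ℂ ⊂ B`. -/
def IsQuantumAutomorphismGroup {B : Type*} [Ring B] [StarRing B] [Algebra ℂ B] [StarModule ℂ B]
    (Q : Type w) [Ring Q] [StarRing Q] [HopfAlgebra ℂ Q] [HopfStarAlgebra Q]
    (ρ : HopfAction Q B) : Prop :=
  IsQuantumGaloisGroup (StarAlgHom.ofId ℂ B) Q ρ

/-- The quantum Galois group of `ι : N → M` exists and is isomorphic, as a Hopf `*`-algebra,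
to `K`. -/
def QuantumGaloisGroupIsoTo {N M : Type*} [Ring N] [StarRing N] [Algebra ℂ N]
    [Ring M] [StarRing M] [Algebra ℂ M] (ι : N →⋆ₐ[ℂ] M)
    (K : Type w) [Ring K] [StarRing K] [HopfAlgebra ℂ K] [HopfStarAlgebra K] : Prop :=
  (∃ σ : HopfAction K M, IsQuantumGaloisGroup ι K σ) ∧
    ∀ (G : Type w) [Ring G] [StarRing G] [HopfAlgebra ℂ G] [HopfStarAlgebra G]
      (σ : HopfAction G M), IsQuantumGaloisGroup ι G σ →
      ∃ e : G ≃ₐc[ℂ] K, ∀ x, e (star x) = star (e x)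

section VonNeumann

variable {𝓗 : Type*} [NormedAddCommGroup 𝓗] [InnerProductSpace ℂ 𝓗] [CompleteSpace 𝓗]

/-- A `II₁` factor: a finite infinite-dimensional factor. -/
structure IsII₁Factor (M : VonNeumannAlgebra 𝓗) : Prop where
  factor : ∀ x ∈ M, x ∈ M.commutant → ∃ c : ℂ, x = c • (1 : 𝓗 →L[ℂ] 𝓗)
  finite : ∀ u ∈ M, star u * u = 1 → u * star u = 1
  infiniteDimensional : ¬ FiniteDimensional ℂ M.toStarSubalgebra

/-- The hyperfinite `II₁` factor: generated by an increasing sequence of finite-dimensional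
`*`-subalgebras. -/
structure IsHyperfiniteII₁Factor (R : VonNeumannAlgebra 𝓗) : Prop extends IsII₁Factor R where
  hyperfinite : ∃ F : ℕ → StarSubalgebra ℂ (𝓗 →L[ℂ] 𝓗), Monotone F ∧
    (∀ n, FiniteDimensional ℂ (F n)) ∧
    Set.centralizer (Set.centralizer (⋃ n, (F n : Set (𝓗 →L[ℂ] 𝓗)))) = (R : Set (𝓗 →L[ℂ] 𝓗))

end VonNeumann

end QuantumGalois

open QuantumGalois

universe u v w

/-! ### Antipodes, homomorphisms and comultiplication. -/

namespace QuantumGalois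

/-! Write `C` for the invariants. The point is that `C` is built from `A` and a copy of `B`, and
that an operator on `C` which is linear over `A` on both sides can only move the copy of `B`, and
does so equivariantly for the coaction `β`.

The copy of `B` is `b ↦ b₀ ⊗ (1 ⋊ b₁)` (`embed`). Applying a counit to the invariance equation shows
that every element of `C` is a sum of products `a · embed b` (`coe_mulEmbed_counitRight`). If a Hopf
`*`-algebra acts on `C` and fixes `A`, each of its elements acts by an `A`-bimodule map, which is
therefore determined by its values on `embed B`.

Let `F` be such a map restricted to `B`. In `A ⋊ H^cop` one has `h a = (h₂ · a) h₁`, so `embed b`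
and `a` satisfy an exchange relation, and `F` inherits it: `F(b) a = (b₁ · a) F(b₀)` (`IsTwisted`).
Correcting `F` by the antipode gives `b ↦ F(b₀) S(b₁)`, whose values commute with `A`
(`IsTwisted.twistMap_commute`). Outerness forces the relative commutant of `A` in `B ⊗ (A ⋊ H^cop)`
to be `B ⊗ 1`, so these values are `T(b) ⊗ 1` for an operator `T` on `B`. Undoing the correction
gives `F(b) = T(b₀) ⊗ (1 ⋊ b₁)`, while invariance of `F(b)` gives `F(b) = embed (T b)`. Comparing
the two, `β(T b) = T(b₀) ⊗ b₁`: `T` is equivariant (`IsTwisted.exists_eq_embed`).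

Conversely, an action on `B` by equivariant operators extends to `C` by acting on the first leg
(`inducedAction`). Thus actions on `C` fixing `A` are the same as equivariant actions on `B`.
Because the Haar state is faithful, the functionals `τ(· S(h))` separate points, and equivariance
means commuting with their action (`commute_dualAction_iff`).

Finally, an action on `B` is a homomorphism to `Q_aut(B)`, and it is equivariant exactly when its
image, which is a Hopf `*`-subalgebra, lies in the Hopf centralizer. So the centralizer with its
induced action on `C` is terminal. The subfactor statement follows by transport along the given
isomorphism. -/

/-- Uniqueness of convolution inverses: `φ ∘ S` is a left inverse of `φ` and `S ∘ φ` is a right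
inverse. -/
theorem map_antipode_of_bialgHom {K Q : Type*} [Ring K] [HopfAlgebra ℂ K] [Ring Q]
    [HopfAlgebra ℂ Q] (φ : K →ₐc[ℂ] Q) (x : K) : φ (antipode ℂ x) = antipode ℂ (φ x) := by
  let f : K →ₐ[ℂ] Q := φ
  have h1 : WithConv.toConv (f.toLinearMap ∘ₗ antipode ℂ) * WithConv.toConv f.toLinearMap = 1 := by
    have h := LinearMap.algHom_comp_convMul_distrib f (WithConv.toConv (antipode ℂ (A := K)))
      (WithConv.toConv LinearMap.id)
    rw [LinearMap.antipode_mul_id] at h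
    refine (congrArg WithConv.toConv h).symm.trans ?_
    ext x
    simp
  have h2 : WithConv.toConv f.toLinearMap * WithConv.toConv (antipode ℂ ∘ₗ f.toLinearMap) = 1 := by
    have h := LinearMap.convMul_comp_coalgHom_distrib (WithConv.toConv LinearMap.id)
      (WithConv.toConv (antipode ℂ (A := Q))) (φ : K →ₗc[ℂ] Q)
    rw [LinearMap.id_mul_antipode] at h
    refine (congrArg WithConv.toConv h).symm.trans ?_
    ext x
    simp
  exact LinearMap.congr_fun (WithConv.toConv_injective (left_inv_eq_right_inv h1 h2)) x

/-- The antipode reverses the comultiplication. -/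
theorem comul_antipode {K : Type*} [Ring K] [HopfAlgebra ℂ K] (x : K) :
    comul (R := ℂ) (antipode ℂ x) =
      TensorProduct.map (antipode ℂ) (antipode ℂ) (TensorProduct.comm ℂ K K (comul (R := ℂ) x)) := by
  let l : K →ₐ[ℂ] K ⊗[ℂ] K := Algebra.TensorProduct.includeLeft
  let r : K →ₐ[ℂ] K ⊗[ℂ] K := Algebra.TensorProduct.includeRight
  have inv : ∀ f : K →ₐ[ℂ] K ⊗[ℂ] K,
      WithConv.toConv (f.toLinearMap ∘ₗ antipode ℂ) * WithConv.toConv f.toLinearMap = 1 := by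
    intro f
    have h := LinearMap.algHom_comp_convMul_distrib f (WithConv.toConv (antipode ℂ (A := K)))
      (WithConv.toConv LinearMap.id)
    rw [LinearMap.antipode_mul_id] at h
    refine (congrArg WithConv.toConv h).symm.trans ?_
    ext x
    simp
  -- The comultiplication is the convolution product of the two inclusions of `K` into `K ⊗ K`. Each
  -- inclusion has the inverse obtained by composing with `S`, so the product of these in reversed
  -- order inverts `Δ`, as `Δ ∘ S` also does.
  have h1 : WithConv.toConv (comul (R := ℂ) (A := K)) =
      WithConv.toConv l.toLinearMap * WithConv.toConv r.toLinearMap := by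
    ext x
    rw [LinearMap.convMul_apply]
    change comul (R := ℂ) x = _
    generalize comul (R := ℂ) x = t
    induction t with
    | zero => simp
    | add x y hx hy => simp only [map_add, ← hx, ← hy]
    | tmul u v => simp [l, r]
  have h2 : WithConv.toConv (r.toLinearMap ∘ₗ antipode ℂ) *
      WithConv.toConv (l.toLinearMap ∘ₗ antipode ℂ) *
      WithConv.toConv (comul (R := ℂ) (A := K)) = 1 := by
    rw [h1, mul_assoc, ← mul_assoc _ (WithConv.toConv l.toLinearMap), inv l, one_mul, inv r]
  have h3 := left_inv_eq_right_inv h2 LinearMap.comul_right_inv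
  have h4 := LinearMap.congr_fun (congrArg WithConv.ofConv h3) x
  refine h4.symm.trans ?_
  change LinearMap.mul' ℂ _ (TensorProduct.map _ _ (comul (R := ℂ) x)) = _
  generalize comul (R := ℂ) x = t
  induction t with
  | zero => simp
  | add x y hx hy => simp only [map_add, hx, hy]
  | tmul u v => simp [l, r]

/-! ### Constructions on actions, and linearity over the fixed algebra. -/

namespace HopfAction
variable {Q M : Type*} [Ring Q] [StarRing Q] [HopfAlgebra ℂ Q] [Ring M] [StarRing M] [Algebra ℂ M]

/-- Restriction of an action along a homomorphism of Hopf `*`-algebras. -/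
noncomputable def comp {Q' : Type*} [Ring Q'] [StarRing Q'] [HopfAlgebra ℂ Q']
    (ρ : HopfAction Q M) (φ : Q' →ₐc[ℂ] Q) (hφ : ∀ x, φ (star x) = star (φ x)) :
    HopfAction Q' M where
  toAlgHom := ρ.toAlgHom.comp (φ : Q' →ₐ[ℂ] Q)
  map_mul' q x y := by
    have h := ρ.map_mul' (φ q) x y
    rw [← CoalgHomClass.map_comp_comul_apply] at h
    refine h.trans ?_
    generalize comul (R := ℂ) q = t
    induction t with
    | zero => simp
    | add x y hx hy => simp only [map_add, hx, hy]
    | tmul u v => simp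
  map_one' q := by
    refine (ρ.map_one' (φ q)).trans ?_
    rw [CoalgHomClass.counit_comp_apply]
  map_star' q x := by
    refine (ρ.map_star' (φ q) x).trans ?_
    rw [← map_antipode_of_bialgHom, ← hφ]
    rfl

/-- An action on `M` that preserves the image of an injective `*`-homomorphism `j : N → M`
restricts to `N`. -/
noncomputable def ofInjective {N : Type*} [Ring N] [StarRing N] [Algebra ℂ N]
    (ρ : HopfAction Q M) (j : N →⋆ₐ[ℂ] M) (hj : Function.Injective j)
    (T : Q →ₗ[ℂ] Module.End ℂ N) (hT : ∀ q n, j (T q n) = ρ.toAlgHom q (j n)) :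
    HopfAction Q N where
  toAlgHom := AlgHom.ofLinearMap T
    (LinearMap.ext fun n => hj (by rw [hT, map_one]; rfl))
    (fun p q => LinearMap.ext fun n => hj (by
      rw [hT, map_mul, Module.End.mul_apply, Module.End.mul_apply, hT, hT]))
  map_mul' q x y := hj (by
    refine (hT q (x * y)).trans ?_
    rw [map_mul, ρ.map_mul']
    generalize comul (R := ℂ) q = t
    induction t with
    | zero => simp
    | add x y hx hy => simp only [map_add, hx, hy]
    | tmul u v => simp [hT])
  map_one' q := hj (by
    refine (hT q 1).trans ?_
    rw [map_one, ρ.map_one', map_smul, map_one])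
  map_star' q x := hj (by
    refine (map_star j _).trans ((congrArg star (hT q x)).trans ?_)
    rw [ρ.map_star', ← map_star j]
    exact (hT _ _).symm)

/-- The action `q · (m ⊗ s) = (q · m) ⊗ s` on `M ⊗ S`. -/
noncomputable def rTensor [StarModule ℂ M] (ρ : HopfAction Q M) (S : Type*) [Ring S] [StarRing S]
    [Algebra ℂ S] [StarModule ℂ S] : HopfAction Q (M ⊗[ℂ] S) where
  toAlgHom := AlgHom.ofLinearMap (LinearMap.rTensorHom S ∘ₗ ρ.toAlgHom.toLinearMap)
    (by
      apply TensorProduct.ext'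
      intro x s
      simp)
    (fun p q => by
      apply TensorProduct.ext'
      intro x s
      simp)
  map_mul' q x y := by
    -- In the form `mul' ∘ map f g` the right side is visibly additive in `f` and `g`, which lets
    -- the induction on `x` and `y` reduce to pure tensors.
    have lift_eq : ∀ f g : Q →ₗ[ℂ] M ⊗[ℂ] S, ∀ t : Q ⊗[ℂ] Q,
        TensorProduct.lift ((LinearMap.mul ℂ (M ⊗[ℂ] S)).compl₁₂ f g) t =
          LinearMap.mul' ℂ _ (TensorProduct.map f g t) := by
      intro f g t
      induction t with
      | zero => simp
      | add u v hu hv => simp only [map_add, hu, hv]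
      | tmul u v => simp
    rw [lift_eq]
    induction x with
    | zero => simp
    | add x x' hx hx' =>
      rw [add_mul, map_add, hx, hx', map_add, TensorProduct.map_add_left, LinearMap.add_apply,
        map_add]
    | tmul m s =>
    induction y with
    | zero => simp
    | add x x' hx hx' =>
      rw [mul_add, map_add, hx, hx', map_add, TensorProduct.map_add_right, LinearMap.add_apply,
        map_add]
    | tmul n r =>
      simp only [Algebra.TensorProduct.tmul_mul_tmul, AlgHom.ofLinearMap_apply,
        LinearMap.comp_apply, LinearMap.coe_rTensorHom, AlgHom.toLinearMap_apply,
        LinearMap.rTensor_tmul, ρ.map_mul']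
      generalize comul (R := ℂ) q = t
      induction t with
      | zero => simp
      | add u v hu hv => simp only [map_add, TensorProduct.add_tmul, hu, hv]
      | tmul u v => simp
  map_one' q := by
    simp [Algebra.TensorProduct.one_def, ρ.map_one', TensorProduct.smul_tmul']
  map_star' q x := by
    induction x with
    | zero => simp
    | add x y hx hy => simp only [star_add, map_add, hx, hy]
    | tmul m s => simp [ρ.map_star']

/-- Scalars are fixed by every action, so any action on `B` may be fed to the universal property of
`Q_aut(B)`. -/
theorem fixes_ofId [StarModule ℂ M] (ρ : HopfAction Q M) : ρ.Fixes (StarAlgHom.ofId ℂ M) := by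
  intro q z
  have h : StarAlgHom.ofId ℂ M z = z • (1 : M) := Algebra.algebraMap_eq_smul_one z
  rw [h, map_smul, ρ.map_one', smul_comm]

variable {N : Type*} [Ring N] [StarRing N] [Algebra ℂ N] {ι : N →⋆ₐ[ℂ] M}

/-- By the counit axiom, `q · (n x) = (q₁ · n)(q₂ · x) = n (ε(q₁) q₂ · x) = n (q · x)`. Together
with the right-handed version, elements of `Q` act by `N`-bimodule maps. -/
theorem Fixes.map_left_mul {ρ : HopfAction Q M} (h : ρ.Fixes ι) (q : Q) (n : N) (x : M) :
    ρ.toAlgHom q (ι n * x) = ι n * ρ.toAlgHom q x := by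
  rw [ρ.map_mul']
  have h1 : ∀ t : Q ⊗[ℂ] Q, TensorProduct.lift ((LinearMap.mul ℂ M).compl₁₂
      (ρ.toAlgHom.toLinearMap.flip (ι n)) (ρ.toAlgHom.toLinearMap.flip x)) t =
      ι n * ρ.toAlgHom (TensorProduct.lid ℂ Q ((counit (R := ℂ)).rTensor Q t)) x := by
    intro t
    induction t with
    | zero => simp
    | add u v hu hv => simp only [map_add, LinearMap.add_apply, mul_add, hu, hv]
    | tmul u v => simp [h _ _]
  rw [h1, Coalgebra.rTensor_counit_comul]
  simp

theorem Fixes.map_right_mul {ρ : HopfAction Q M} (h : ρ.Fixes ι) (q : Q) (n : N) (x : M) :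
    ρ.toAlgHom q (x * ι n) = ρ.toAlgHom q x * ι n := by
  rw [ρ.map_mul']
  have h1 : ∀ t : Q ⊗[ℂ] Q, TensorProduct.lift ((LinearMap.mul ℂ M).compl₁₂
      (ρ.toAlgHom.toLinearMap.flip x) (ρ.toAlgHom.toLinearMap.flip (ι n))) t =
      ρ.toAlgHom (TensorProduct.rid ℂ Q ((counit (R := ℂ)).lTensor Q t)) x * ι n := by
    intro t
    induction t with
    | zero => simp
    | add u v hu hv => simp only [map_add, LinearMap.add_apply, add_mul, hu, hv]
    | tmul u v => simp [h _ _]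
  rw [h1, Coalgebra.lTensor_counit_comul]
  simp

end HopfAction

/-! ### Images and joins of Hopf `*`-subalgebras, and existence of the Hopf centralizer. -/

namespace HopfStarSubalgebra
variable {Q : Type*} [Ring Q] [StarRing Q] [HopfAlgebra ℂ Q] [HopfStarAlgebra Q]

/-- The inclusion of a Hopf `*`-subalgebra as a homomorphism of bialgebras. -/
noncomputable def val (K : HopfStarSubalgebra Q) : K.toStarSubalgebra →ₐc[ℂ] Q :=
  { K.toStarSubalgebra.subtype.toAlgHom with
    map_smul' := fun _ _ => rfl
    counit_comp := rfl
    map_comp_comul := LinearMap.ext fun x => K.map_incl_comul x }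

variable {Q' : Type*} [Ring Q'] [HopfAlgebra ℂ Q']

/-- The image of a homomorphism of Hopf `*`-algebras. -/
noncomputable def range [StarRing Q'] (φ : Q' →ₐc[ℂ] Q) (hφ : ∀ x, φ (star x) = star (φ x)) :
    HopfStarSubalgebra Q where
  toStarSubalgebra :=
    { (φ : Q' →ₐ[ℂ] Q).range with
      star_mem' := by
        rintro _ ⟨x, rfl⟩
        exact ⟨star x, hφ x⟩ }
  comul_mem' := by
    rintro _ ⟨x, rfl⟩
    change comul (R := ℂ) (φ x) ∈ _
    rw [← CoalgHomClass.map_comp_comul_apply]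
    generalize comul (R := ℂ) x = t
    induction t with
    | zero => simp
    | add x y hx hy =>
      rw [map_add]
      exact Submodule.add_mem _ hx hy
    | tmul u v => exact ⟨⟨φ u, u, rfl⟩ ⊗ₜ ⟨φ v, v, rfl⟩, rfl⟩
  antipode_mem' := by
    rintro _ ⟨x, rfl⟩
    exact ⟨antipode ℂ x, map_antipode_of_bialgHom φ x⟩

/-- Restriction of the codomain of a homomorphism to a Hopf `*`-subalgebra. -/
noncomputable def codRestrict (K : HopfStarSubalgebra Q) (φ : Q' →ₐc[ℂ] Q)
    (hK : ∀ x, φ x ∈ K.toStarSubalgebra) : Q' →ₐc[ℂ] K.toStarSubalgebra :=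
  let f : Q' →ₐ[ℂ] K.toStarSubalgebra :=
    (φ : Q' →ₐ[ℂ] Q).codRestrict K.toStarSubalgebra.toSubalgebra hK
  { f with
    map_smul' := fun c x => map_smul f c x
    counit_comp := LinearMap.ext fun x => CoalgHomClass.counit_comp_apply φ x
    map_comp_comul := LinearMap.ext fun x => by
      apply K.map_incl_injective
      change _ = TensorProduct.map K.incl K.incl (comul (R := ℂ) (f x))
      rw [map_incl_comul]
      change _ = comul (R := ℂ) (φ x)
      rw [← CoalgHomClass.map_comp_comul_apply]
      change TensorProduct.map K.incl K.incl
        (TensorProduct.map f.toLinearMap f.toLinearMap (comul (R := ℂ) x)) = _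
      generalize comul (R := ℂ) x = t
      induction t with
      | zero => simp
      | add x y hx hy => simp only [map_add, hx, hy]
      | tmul u v => rfl }

/-- The Hopf `*`-subalgebra generated by a family of Hopf `*`-subalgebras. -/
noncomputable def sSup (F : Set (HopfStarSubalgebra Q)) : HopfStarSubalgebra Q where
  toStarSubalgebra :=
    { Algebra.adjoin ℂ {x | ∃ L ∈ F, x ∈ L.toStarSubalgebra} with
      star_mem' := by
        intro x hx
        induction hx using Algebra.adjoin_induction with
        | mem x hx =>
          obtain ⟨L, hL, hx⟩ := hx
          exact Algebra.subset_adjoin ⟨L, hL, L.toStarSubalgebra.star_mem' hx⟩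
        | algebraMap r =>
          rw [← algebraMap_star_comm]
          exact Subalgebra.algebraMap_mem _ _
        | add x y _ _ hx hy =>
          rw [star_add]
          exact Subalgebra.add_mem _ hx hy
        | mul x y _ _ hx hy =>
          rw [star_mul]
          exact Subalgebra.mul_mem _ hy hx }
  comul_mem' := by
    intro x hx
    let D := Algebra.adjoin ℂ {x | ∃ L ∈ F, x ∈ L.toStarSubalgebra}
    change comul (R := ℂ) x ∈ (Algebra.TensorProduct.map D.val D.val).range
    -- As `Δ` is an algebra homomorphism, the elements with `Δ(x)` in the image of `D ⊗ D` form a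
    -- subalgebra, so the generators suffice.
    suffices h : D ≤ (Algebra.TensorProduct.map D.val D.val).range.comap
        (Bialgebra.comulAlgHom ℂ Q) from h hx
    refine Algebra.adjoin_le ?_
    rintro y ⟨L, hL, hy⟩
    obtain ⟨t, ht⟩ := L.comul_mem' y hy
    change comul (R := ℂ) y ∈ (Algebra.TensorProduct.map D.val D.val).range
    rw [← ht]
    clear ht
    induction t with
    | zero => simp
    | add x y hx hy =>
      rw [map_add]
      exact Subalgebra.add_mem _ hx hy
    | tmul u v =>
      exact ⟨⟨u, Algebra.subset_adjoin ⟨L, hL, u.2⟩⟩ ⊗ₜ ⟨v, Algebra.subset_adjoin ⟨L, hL, v.2⟩⟩,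
        rfl⟩
  antipode_mem' := by
    intro x hx
    change antipode ℂ x ∈ Algebra.adjoin ℂ {x | ∃ L ∈ F, x ∈ L.toStarSubalgebra}
    induction hx using Algebra.adjoin_induction with
    | mem x hx =>
      obtain ⟨L, hL, hx⟩ := hx
      exact Algebra.subset_adjoin ⟨L, hL, L.antipode_mem' x hx⟩
    | algebraMap r =>
      rw [Algebra.algebraMap_eq_smul_one, map_smul, antipode_one]
      exact Subalgebra.smul_mem _ (Subalgebra.one_mem _) _
    | add x y _ _ hx hy =>
      rw [map_add]
      exact Subalgebra.add_mem _ hx hy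
    | mul x y _ _ hx hy =>
      rw [antipode_mul_antidistrib]
      exact Subalgebra.mul_mem _ hy hx

/-- Take the join of all Hopf `*`-subalgebras whose elements act by operators commuting with `S`. It
still has this property, because the elements acting by operators that commute with a given `T` form
a subalgebra of `Q`. -/
theorem exists_isHopfCentralizer {B : Type*} [Ring B] [StarRing B] [Algebra ℂ B]
    (ρ : HopfAction Q B) (S : Set (Module.End ℂ B)) :
    ∃ K : HopfStarSubalgebra Q, IsHopfCentralizer ρ S K := by
  refine ⟨sSup {L | ∀ q ∈ L.toStarSubalgebra, ∀ T ∈ S,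
    ρ.toAlgHom q * T = T * ρ.toAlgHom q}, ?_, ?_⟩
  · intro q hq T hT
    suffices h : Algebra.adjoin ℂ _ ≤ (Subalgebra.centralizer ℂ {T}).comap ρ.toAlgHom from
      ((Subalgebra.mem_centralizer_iff ℂ).1 (h hq) T rfl).symm
    refine Algebra.adjoin_le ?_
    rintro x ⟨L, hL, hx⟩
    refine (Subalgebra.mem_centralizer_iff ℂ).2 ?_
    rintro _ rfl
    exact (hL x hx _ hT).symm
  · intro L hL q hq
    exact Algebra.subset_adjoin ⟨L, hL, hq⟩

end HopfStarSubalgebra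

/-! ### Uniqueness and transport of quantum Galois groups. -/

section Terminal
variable {N M : Type*} [Ring N] [StarRing N] [Algebra ℂ N] [Ring M] [StarRing M] [Algebra ℂ M]
  {ι : N →⋆ₐ[ℂ] M}

/-- Terminal objects are isomorphic: the two comparison maps compose to endomorphisms of terminal
objects, which must be identities. -/
theorem quantumGaloisGroupIsoTo_of_isQuantumGaloisGroup
    {K : Type w} [Ring K] [StarRing K] [HopfAlgebra ℂ K] [HopfStarAlgebra K]
    {σ : HopfAction K M} (hσ : IsQuantumGaloisGroup ι K σ) : QuantumGaloisGroupIsoTo ι K := by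
  refine ⟨⟨σ, hσ⟩, fun G _ _ _ _ θ hθ => ?_⟩
  obtain ⟨f, ⟨hf, hf'⟩, -⟩ := hσ.terminal G θ hθ.fixes
  obtain ⟨g, ⟨hg, hg'⟩, -⟩ := hθ.terminal K σ hσ.fixes
  have h1 : f.comp g = BialgHom.id ℂ K :=
    (hσ.terminal K σ hσ.fixes).unique
      ⟨fun x => (congrArg f (hg x)).trans (hf _), fun q m => (hf' _ m).trans (hg' q m)⟩
      ⟨fun _ => rfl, fun _ _ => rfl⟩
  have h2 : g.comp f = BialgHom.id ℂ G :=
    (hθ.terminal G θ hθ.fixes).unique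
      ⟨fun x => (congrArg g (hf x)).trans (hg _), fun q m => (hg' _ m).trans (hf' q m)⟩
      ⟨fun _ => rfl, fun _ _ => rfl⟩
  exact ⟨BialgEquiv.ofBialgHom f g h1 h2, hf⟩

variable {M' : Type*} [Ring M'] [StarRing M'] [Algebra ℂ M'] {ι' : N →⋆ₐ[ℂ] M'}

/-- Transport of an action along an isomorphism. -/
noncomputable def HopfAction.transport {Q : Type*} [Ring Q] [StarRing Q] [HopfAlgebra ℂ Q]
    (σ : HopfAction Q M') (Φ : M ≃⋆ₐ[ℂ] M') : HopfAction Q M :=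
  σ.ofInjective (Φ : M →⋆ₐ[ℂ] M') Φ.injective
    { toFun := fun q => (Φ.symm : M' →⋆ₐ[ℂ] M).toAlgHom.toLinearMap ∘ₗ σ.toAlgHom q ∘ₗ
        (Φ : M →⋆ₐ[ℂ] M').toAlgHom.toLinearMap
      map_add' := fun p q => by ext x; simp
      map_smul' := fun c q => by ext x; simp }
    (fun q x => Φ.apply_symm_apply _)

theorem HopfAction.transport_apply {Q : Type*} [Ring Q] [StarRing Q] [HopfAlgebra ℂ Q]
    (σ : HopfAction Q M') (Φ : M ≃⋆ₐ[ℂ] M') (q : Q) (m : M) :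
    (σ.transport Φ).toAlgHom q m = Φ.symm (σ.toAlgHom q (Φ m)) := rfl

theorem QuantumGaloisGroupIsoTo.transport
    {K : Type w} [Ring K] [StarRing K] [HopfAlgebra ℂ K] [HopfStarAlgebra K]
    (h : QuantumGaloisGroupIsoTo ι' K) (Φ : M ≃⋆ₐ[ℂ] M') (hΦ : ∀ n, Φ (ι n) = ι' n) :
    QuantumGaloisGroupIsoTo ι K := by
  obtain ⟨⟨σ, hσ⟩, -⟩ := h
  have hΦ' : ∀ n, Φ.symm (ι' n) = ι n := fun n => by rw [← hΦ, Φ.symm_apply_apply]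
  refine quantumGaloisGroupIsoTo_of_isQuantumGaloisGroup (σ := σ.transport Φ) ⟨?_, ?_⟩
  · intro q n
    rw [HopfAction.transport_apply, hΦ, hσ.fixes, map_smul, hΦ']
  · intro Q' _ _ _ _ ρ' hρ'
    have hfix : (ρ'.transport Φ.symm).Fixes ι' := by
      intro q n
      rw [HopfAction.transport_apply, hΦ', hρ', map_smul, StarAlgEquiv.symm_symm, hΦ]
    -- Intertwining over `M` and intertwining over `M'` are the same condition on `φ`, so the
    -- universal property carries over verbatim.
    have key : ∀ φ : Q' →ₐc[ℂ] K,
        (∀ q m, (σ.transport Φ).toAlgHom (φ q) m = ρ'.toAlgHom q m) ↔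
        ∀ q m, σ.toAlgHom (φ q) m = (ρ'.transport Φ.symm).toAlgHom q m := by
      intro φ
      constructor
      · intro h q m
        rw [HopfAction.transport_apply, ← h, HopfAction.transport_apply, StarAlgEquiv.symm_symm,
          Φ.apply_symm_apply, Φ.apply_symm_apply]
      · intro h q m
        rw [HopfAction.transport_apply, h, HopfAction.transport_apply, StarAlgEquiv.symm_symm,
          Φ.symm_apply_apply, Φ.symm_apply_apply]
    simpa only [key] using hσ.terminal Q' (ρ'.transport Φ.symm) hfix

end Terminal

set_option linter.unusedSectionVars false

/-! ### The smash product: the copy of `K`, and relative commutants. -/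

namespace Smash

section
variable {K A : Type*} [Ring K] [StarRing K] [HopfAlgebra ℂ K] [HopfStarAlgebra K]
  [Ring A] [StarRing A] [Algebra ℂ A] [StarModule ℂ A] (α : HopfAction K A)

/-- The inclusion `h ↦ 1 ⋊ h` as a `*`-homomorphism. -/
noncomputable def ofRightHom : K →⋆ₐ[ℂ] Smash α :=
  { AlgHom.ofLinearMap (ofRight α) rfl (fun h g => (mul_one_tmul α 1 h g).symm) with
    map_star' := fun h => by
      change tmul α 1 (star h) = star (tmul α 1 h)
      rw [star_tmul, star_one]
      exact (mul_one _).symm }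

theorem ofRightHom_apply (h : K) : ofRightHom α h = tmul α 1 h := rfl

theorem ofRightHom_mul_ofLeft (h : K) (a : A) : ofRightHom α h * ofLeft α a =
    TensorProduct.lift ((LinearMap.mul ℂ (Smash α)).compl₁₂
      ((ofLeft α).toAlgHom.toLinearMap ∘ₗ α.toAlgHom.toLinearMap.flip a)
      (ofRightHom α).toAlgHom.toLinearMap) (comul (R := ℂ) h) := by
  refine (tmul_mul_tmul α 1 a h 1 (ℛ ℂ h)).trans ?_
  conv_rhs => rw [← (ℛ ℂ h).eq]
  rw [map_sum]
  refine Finset.sum_congr rfl fun i _ => ?_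
  rw [one_mul, mul_one, tmul_eq]
  rfl

/-- The map `a ⋊ h ↦ ε(h) a`. -/
noncomputable def counitRight : Smash α →ₗ[ℂ] A :=
  (TensorProduct.rid ℂ A).toLinearMap ∘ₗ (counit (R := ℂ)).lTensor A ∘ₗ
    (equivTensor α).toLinearMap

theorem counitRight_tmul (a : A) (h : K) :
    counitRight α (tmul α a h) = counit (R := ℂ) h • a := by
  simp [counitRight]

theorem coaction_ofRightHom (h : K) : coaction α (ofRightHom α h) =
    (ofRightHom α).toAlgHom.toLinearMap.rTensor K (comul (R := ℂ) h) := by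
  rw [ofRightHom_apply, coaction_tmul]
  change (1 : Smash α ⊗[ℂ] K) * _ = _
  rw [one_mul]
  rfl

/-- Slice the `A`-leg by a functional that does not vanish at `1`, suitably normalised. Such a
functional exists because `A ≠ 0`. -/
theorem exists_ofRightHom_leftInverse [Nontrivial A] :
    ∃ v : Smash α →ₗ[ℂ] K, ∀ h, v (ofRightHom α h) = h := by
  obtain ⟨f, hf⟩ := Module.Projective.exists_dual_ne_zero ℂ (one_ne_zero (α := A))
  refine ⟨(f 1)⁻¹ • ((TensorProduct.lid ℂ K).toLinearMap ∘ₗ f.rTensor K ∘ₗ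
    (equivTensor α).toLinearMap), fun h => ?_⟩
  simp [ofRightHom_apply, smul_smul, inv_mul_cancel₀ hf]

/-- If the action is outer, the relative commutant of `A` in `B ⊗ (A ⋊ K)` is `B`. -/
theorem exists_eq_tmul_one_of_commute (hα : α.IsOuter) {B : Type*} [Ring B] [Algebra ℂ B]
    (x : B ⊗[ℂ] Smash α)
    (hx : ∀ a : A, x * ((1 : B) ⊗ₜ ofLeft α a) = ((1 : B) ⊗ₜ ofLeft α a) * x) :
    ∃ b : B, x = b ⊗ₜ 1 := by
  classical
  -- In coordinates along a basis of `B`, left and right multiplication by `1 ⊗ s` act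
  -- coordinatewise. Hence each coordinate of `x` commutes with `A`, and outerness makes it a
  -- scalar.
  let e := Module.Basis.ofVectorSpace ℂ B
  have hr : ∀ (s : Smash α) (y : B ⊗[ℂ] Smash α) i,
      TensorProduct.equivFinsuppOfBasisLeft e (y * ((1 : B) ⊗ₜ s)) i =
      TensorProduct.equivFinsuppOfBasisLeft e y i * s := by
    intro s y i
    induction y with
    | zero => simp
    | add x y hx hy => simp only [add_mul, map_add, Finsupp.add_apply, hx, hy]
    | tmul b r => simp
  have hl : ∀ (s : Smash α) (y : B ⊗[ℂ] Smash α) i,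
      TensorProduct.equivFinsuppOfBasisLeft e (((1 : B) ⊗ₜ s) * y) i =
      s * TensorProduct.equivFinsuppOfBasisLeft e y i := by
    intro s y i
    induction y with
    | zero => simp
    | add x y hx hy => simp only [mul_add, map_add, Finsupp.add_apply, hx, hy]
    | tmul b r => simp
  have hc : ∀ i, ∃ c : ℂ, TensorProduct.equivFinsuppOfBasisLeft e x i = c • (1 : Smash α) := by
    intro i
    refine hα _ fun a => ?_
    refine (hl (ofLeft α a) x i).symm.trans ?_
    rw [← hx, hr]
    rfl
  choose c hc using hc
  refine ⟨(TensorProduct.equivFinsuppOfBasisLeft e x).sum fun i _ => c i • e i, ?_⟩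
  conv_lhs => rw [← (TensorProduct.equivFinsuppOfBasisLeft e).symm_apply_apply x,
    TensorProduct.equivFinsuppOfBasisLeft_symm_apply]
  rw [Finsupp.sum, Finsupp.sum, TensorProduct.sum_tmul]
  refine Finset.sum_congr rfl fun i _ => ?_
  rw [hc, TensorProduct.tmul_smul, TensorProduct.smul_tmul']

end
end Smash

/-! ### The copy of `B` in the invariants, and generation by `A` and `B`. -/

section Invariants

variable {H A B : Type*} [Ring H] [StarRing H] [HopfAlgebra ℂ H] [HopfStarAlgebra H]
  [InvolutiveAntipode H] [Ring A] [StarRing A] [Algebra ℂ A] [StarModule ℂ A]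
  [Ring B] [StarRing B] [Algebra ℂ B] [StarModule ℂ B]
  (β : Coaction B H) (α : HopfAction (Cop H) A)

namespace Invariants

/-- The inclusion `h ↦ 1 ⋊ h` of the algebra `H` into `A ⋊ H^cop`. -/
noncomputable def groupHom : H →ₐ[ℂ] Smash α :=
  (Smash.ofRightHom α).toAlgHom.comp (Cop.of H).toAlgHom

theorem groupHom_apply (h : H) : groupHom α h = Smash.ofRightHom α (Cop.of H h) := rfl

/-- The map `k ↦ k · a`. -/
noncomputable def orbit (a : A) : H →ₗ[ℂ] A :=
  α.toAlgHom.toLinearMap.flip a ∘ₗ (Cop.of H).toLinearMap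

theorem orbit_apply (a : A) (h : H) : orbit α a h = α.toAlgHom (Cop.of H h) a := rfl

theorem orbit_orbit (a : A) (h k : H) : orbit α (orbit α a k) h = orbit α a (h * k) := by
  rw [orbit_apply, orbit_apply, orbit_apply, map_mul, map_mul, Module.End.mul_apply]

theorem orbit_one (a : A) : orbit α a 1 = a := by
  rw [orbit_apply, map_one, map_one, Module.End.one_apply]

/-- `h a = (h₂ · a) h₁` in `A ⋊ H^cop`. -/
theorem groupHom_mul_ofLeft (h : H) (a : A) : groupHom α h * Smash.ofLeft α a =
    TensorProduct.lift ((LinearMap.mul ℂ (Smash α)).flip.compl₁₂ (groupHom α).toLinearMap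
      ((Smash.ofLeft α).toAlgHom.toLinearMap ∘ₗ orbit α a)) (comul (R := ℂ) h) := by
  refine (Smash.ofRightHom_mul_ofLeft α (Cop.of H h) a).trans ?_
  change TensorProduct.lift _ (TensorProduct.comm ℂ H H (comul (R := ℂ) h)) = _
  generalize comul (R := ℂ) h = t
  induction t with
  | zero => simp
  | add x y hx hy => simp only [map_add, hx, hy]
  | tmul u v => rfl

/-- `S(h) a = (S(h₁) · a) S(h₂)` in `A ⋊ H^cop`. -/
theorem groupHom_antipode_mul_ofLeft (h : H) (a : A) :
    groupHom α (antipode ℂ h) * Smash.ofLeft α a =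
    TensorProduct.lift ((LinearMap.mul ℂ (Smash α)).compl₁₂
      ((Smash.ofLeft α).toAlgHom.toLinearMap ∘ₗ orbit α a ∘ₗ antipode ℂ)
      ((groupHom α).toLinearMap ∘ₗ antipode ℂ)) (comul (R := ℂ) h) := by
  rw [groupHom_mul_ofLeft, comul_antipode]
  generalize comul (R := ℂ) h = t
  induction t with
  | zero => simp
  | add x y hx hy => simp only [map_add, hx, hy]
  | tmul u v => simp

/-- The embedding `b ↦ b₀ ⊗ (1 ⋊ b₁)` of `B` into the invariants. -/
noncomputable def embed : B →⋆ₐ[ℂ] B ⊗[ℂ] Smash α :=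
  { (Algebra.TensorProduct.map (AlgHom.id ℂ B) (groupHom α)).comp β.toStarAlgHom.toAlgHom with
    map_star' := fun b => by
      change Algebra.TensorProduct.map (AlgHom.id ℂ B) (groupHom α) (β.toStarAlgHom (star b)) =
        star (Algebra.TensorProduct.map (AlgHom.id ℂ B) (groupHom α) (β.toStarAlgHom b))
      rw [map_star]
      generalize β.toStarAlgHom b = t
      induction t with
      | zero => simp
      | add x y hx hy => simp only [star_add, map_add, hx, hy]
      | tmul u v =>
        have h : groupHom α (star v) = star (groupHom α v) :=
          map_star (Smash.ofRightHom α) (Cop.of H v)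
        simp [h] }

theorem embed_apply (b : B) :
    embed β α b = (groupHom α).toLinearMap.lTensor B (β.toStarAlgHom b) := rfl

/-- The coaction of `H` on `B` as a linear map. -/
noncomputable abbrev coact : B →ₗ[ℂ] B ⊗[ℂ] H := β.toStarAlgHom.toAlgHom.toLinearMap

theorem coact_coassoc (b : B) : TensorProduct.assoc ℂ B H H ((coact β).rTensor H (coact β b)) =
    (comul (R := ℂ)).lTensor B (coact β b) := β.coassoc b

theorem rid_counit_coact (b : B) :
    TensorProduct.rid ℂ B ((counit (R := ℂ)).lTensor B (coact β b)) = b := by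
  have h := congrArg (TensorProduct.rid ℂ B) (β.lTensor_counit b)
  simpa using h

/-- By coassociativity of `β`, both sides of the criterion `prodCoaction_eq_iff` equal `b₀ ⊗ (1 ⋊
b₂) ⊗ b₁`; the swap comes from the reversed comultiplication of `H^cop`. -/
theorem embed_mem (b : B) : embed β α b ∈ invariants β α := by
  change prodCoaction β α _ = _
  rw [prodCoaction_eq_iff, embed_apply]
  let P : B ⊗[ℂ] (H ⊗[ℂ] H) →ₗ[ℂ] B ⊗[ℂ] (Smash α ⊗[ℂ] Cop H) :=
    ((TensorProduct.map (groupHom α).toLinearMap (Cop.of H).toLinearMap) ∘ₗ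
      (TensorProduct.comm ℂ H H).toLinearMap).lTensor B
  have h1 : ∀ t : B ⊗[ℂ] H, homRight α ((groupHom α).toLinearMap.lTensor B t) =
      P ((comul (R := ℂ)).lTensor B t) := by
    intro t
    induction t with
    | zero => simp
    | add x y hx hy => simp only [map_add, hx, hy]
    | tmul c h =>
      change c ⊗ₜ Smash.coaction α (groupHom α h) = _
      rw [groupHom_apply, Smash.coaction_ofRightHom]
      rfl
  have h2 : ∀ t : B ⊗[ℂ] H, homLeft β α ((groupHom α).toLinearMap.lTensor B t) =
      P (TensorProduct.assoc ℂ B H H ((coact β).rTensor H t)) := by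
    intro t
    induction t with
    | zero => simp
    | add x y hx hy => simp only [map_add, hx, hy]
    | tmul c h =>
      rw [LinearMap.lTensor_tmul, homLeft_tmul, LinearMap.rTensor_tmul]
      change TensorProduct.lift _ (coact β c) = _
      generalize coact β c = s
      induction s with
      | zero => simp
      | add x y hx hy => simp only [TensorProduct.add_tmul, map_add, hx, hy]
      | tmul u v => rfl
  rw [h1, h2]
  exact congrArg P (coact_coassoc β b).symm

/-- The embedding of `B` into the invariants. -/
noncomputable def embedInvariants : B →⋆ₐ[ℂ] invariants β α :=
  (embed β α).codRestrict (invariants β α) (embed_mem β α)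

theorem coe_embedInvariants (b : B) : (embedInvariants β α b : B ⊗[ℂ] Smash α) = embed β α b := rfl

/-- The map `b ⊗ a ↦ a b` from `B ⊗ A` to the invariants. -/
noncomputable def mulEmbed : B ⊗[ℂ] A →ₗ[ℂ] invariants β α :=
  TensorProduct.lift ((LinearMap.mul ℂ (invariants β α)).flip.compl₁₂
    (embedInvariants β α).toAlgHom.toLinearMap (inclusion β α).toAlgHom.toLinearMap)

theorem mulEmbed_tmul (b : B) (a : A) :
    mulEmbed β α (b ⊗ₜ a) = inclusion β α a * embedInvariants β α b := rfl

/-- An invariant is recovered from its image in `B ⊗ A` under the counit of `H^cop`. Invariance says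
`homRight x = homLeft x`. Apply to both sides the map `Z`, which takes the counit on the smash leg
and multiplies the result by the last leg: the left side returns `x` by the counit axiom, and the
right side becomes a combination of products `a · embed b`. -/
theorem coe_mulEmbed_counitRight (x : invariants β α) :
    (mulEmbed β α ((Smash.counitRight α).lTensor B x) : B ⊗[ℂ] Smash α) = x := by
  let Z : B ⊗[ℂ] (Smash α ⊗[ℂ] Cop H) →ₗ[ℂ] B ⊗[ℂ] Smash α :=
    (TensorProduct.lift ((LinearMap.mul ℂ (Smash α)).compl₁₂
      ((Smash.ofLeft α).toAlgHom.toLinearMap ∘ₗ Smash.counitRight α)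
      (Smash.ofRightHom α).toAlgHom.toLinearMap)).lTensor B
  have h1 : ∀ y : B ⊗[ℂ] Smash α, Z (homRight α y) = y := by
    intro y
    induction y with
    | zero => simp
    | add x y hx hy => simp only [map_add, hx, hy]
    | tmul b s =>
    induction s using Smash.induction_on with
    | zero => simp
    | add x y hx hy => simp only [TensorProduct.tmul_add, map_add, hx, hy]
    | tmul a h =>
      change b ⊗ₜ TensorProduct.lift _ (Smash.coaction α (Smash.tmul α a h)) = _
      congr 1
      have h0 : Smash.tmul α a h = Smash.tmul α a (TensorProduct.lid ℂ _
          ((counit (R := ℂ)).rTensor (Cop H) (comul (R := ℂ) h))) := by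
        rw [Coalgebra.rTensor_counit_comul]
        simp
      conv_rhs => rw [h0]
      rw [Smash.coaction_tmul]
      generalize comul (R := ℂ) h = t
      induction t with
      | zero =>
        simp only [map_zero, mul_zero]
        exact (map_zero ((Smash.equivTensor α).symm.toLinearMap ∘ₗ TensorProduct.mk ℂ A _ a)).symm
      | add x y hx hy =>
        simp only [map_add, mul_add, hx, hy]
        exact (map_add ((Smash.equivTensor α).symm.toLinearMap ∘ₗ
          TensorProduct.mk ℂ A _ a) _ _).symm
      | tmul u v =>
        have h2 : Smash.tmul α a 1 * Smash.ofRight α u = Smash.tmul α a u :=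
          (Smash.tmul_eq α a u).symm
        rw [LinearMap.rTensor_tmul, Algebra.TensorProduct.tmul_mul_tmul, h2, one_mul]
        simp only [TensorProduct.lift.tmul, LinearMap.compl₁₂_apply, LinearMap.comp_apply,
          Smash.counitRight_tmul, map_smul, LinearMap.rTensor_tmul, TensorProduct.lid_tmul,
          LinearMap.smul_apply]
        refine Eq.trans ?_
          (map_smul ((Smash.equivTensor α).symm.toLinearMap ∘ₗ TensorProduct.mk ℂ A _ a) _ _).symm
        exact congrArg _ (Smash.tmul_eq α a v).symm
  have h2 : ∀ y : B ⊗[ℂ] Smash α, Z (homLeft β α y) =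
      mulEmbed β α ((Smash.counitRight α).lTensor B y) := by
    intro y
    induction y with
    | zero => simp
    | add x y hx hy => simp only [map_add, hx, hy, AddMemClass.coe_add]
    | tmul b s =>
      rw [homLeft_tmul, LinearMap.lTensor_tmul, mulEmbed_tmul]
      change _ = ((1 : B) ⊗ₜ[ℂ] Smash.ofLeft α (Smash.counitRight α s)) * embed β α b
      rw [embed_apply]
      generalize β.toStarAlgHom b = t
      induction t with
      | zero => simp
      | add x y hx hy => simp only [map_add, mul_add, hx, hy]
      | tmul u v =>
        rw [LinearMap.lTensor_tmul, Algebra.TensorProduct.tmul_mul_tmul, one_mul]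
        rfl
  rw [← h2, ← (prodCoaction_eq_iff β α _).1 x.2, h1]

theorem mulEmbed_surjective : Function.Surjective (mulEmbed β α) := fun x =>
  ⟨_, Subtype.ext (coe_mulEmbed_counitRight β α x)⟩

/-! ### Twisted maps, and the use of outerness. -/

/-- A linear map `F` on `B` with `F(b) a = (b₁ · a) F(b₀)`. -/
def IsTwisted (F : B →ₗ[ℂ] B ⊗[ℂ] Smash α) : Prop :=
  ∀ (b : B) (a : A), F b * ((1 : B) ⊗ₜ Smash.ofLeft α a) =
    TensorProduct.lift ((LinearMap.mul ℂ (B ⊗[ℂ] Smash α)).flip.compl₁₂ F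
      (TensorProduct.mk ℂ B (Smash α) 1 ∘ₗ (Smash.ofLeft α).toAlgHom.toLinearMap ∘ₗ orbit α a))
      (coact β b)

/-- The computation is `b₀ ⊗ b₁ a = b₀ ⊗ (b₂ · a) b₁`, with coassociativity regrouping `b₀ ⊗ b₁` as
the embedding of the first leg of `β(b)`. -/
theorem isTwisted_embed : IsTwisted β α (embed β α).toAlgHom.toLinearMap := by
  intro b a
  let P : B ⊗[ℂ] (H ⊗[ℂ] H) →ₗ[ℂ] B ⊗[ℂ] Smash α :=
    (TensorProduct.lift ((LinearMap.mul ℂ (Smash α)).flip.compl₁₂ (groupHom α).toLinearMap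
      ((Smash.ofLeft α).toAlgHom.toLinearMap ∘ₗ orbit α a))).lTensor B
  have h1 : ∀ t : B ⊗[ℂ] H, (groupHom α).toLinearMap.lTensor B t *
      ((1 : B) ⊗ₜ Smash.ofLeft α a) = P ((comul (R := ℂ)).lTensor B t) := by
    intro t
    induction t with
    | zero => simp
    | add x y hx hy => simp only [map_add, add_mul, hx, hy]
    | tmul c h =>
      rw [LinearMap.lTensor_tmul, Algebra.TensorProduct.tmul_mul_tmul, mul_one,
        LinearMap.lTensor_tmul]
      exact congrArg (fun s => c ⊗ₜ s) (groupHom_mul_ofLeft α h a)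
  have h2 : ∀ t : B ⊗[ℂ] H, TensorProduct.lift
      ((LinearMap.mul ℂ (B ⊗[ℂ] Smash α)).flip.compl₁₂ (embed β α).toAlgHom.toLinearMap
      (TensorProduct.mk ℂ B (Smash α) 1 ∘ₗ (Smash.ofLeft α).toAlgHom.toLinearMap ∘ₗ orbit α a)) t =
      P (TensorProduct.assoc ℂ B H H ((coact β).rTensor H t)) := by
    intro t
    induction t with
    | zero => simp
    | add x y hx hy => simp only [map_add, hx, hy]
    | tmul c h =>
      change ((1 : B) ⊗ₜ Smash.ofLeft α (orbit α a h)) * (groupHom α).toLinearMap.lTensor B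
        (coact β c) = P (TensorProduct.assoc ℂ B H H (coact β c ⊗ₜ h))
      generalize coact β c = s
      induction s with
      | zero => simp
      | add x y hx hy => simp only [TensorProduct.add_tmul, map_add, mul_add, hx, hy]
      | tmul u v =>
        rw [LinearMap.lTensor_tmul, Algebra.TensorProduct.tmul_mul_tmul, one_mul]
        rfl
  rw [h2, coact_coassoc, ← h1]
  rfl

/-- The map `b ↦ F(b₀) (1 ⊗ (1 ⋊ f(b₁)))`. -/
noncomputable def twistMap (F : B →ₗ[ℂ] B ⊗[ℂ] Smash α) (f : H →ₗ[ℂ] H) :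
    B →ₗ[ℂ] B ⊗[ℂ] Smash α :=
  TensorProduct.lift ((LinearMap.mul ℂ (B ⊗[ℂ] Smash α)).compl₁₂ F
    (TensorProduct.mk ℂ B (Smash α) 1 ∘ₗ (groupHom α).toLinearMap ∘ₗ f)) ∘ₗ coact β

/-- The antipode correction can be undone, since `F(b₀) S(b₁) b₂ = F(b)`. -/
theorem twistMap_twistMap (F : B →ₗ[ℂ] B ⊗[ℂ] Smash α) :
    twistMap β α (twistMap β α F (antipode ℂ)) LinearMap.id = F := by
  let P : B ⊗[ℂ] (H ⊗[ℂ] H) →ₗ[ℂ] B ⊗[ℂ] Smash α :=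
    TensorProduct.lift ((LinearMap.mul ℂ (B ⊗[ℂ] Smash α)).compl₁₂ F
      (TensorProduct.mk ℂ B (Smash α) 1 ∘ₗ (groupHom α).toLinearMap ∘ₗ
        LinearMap.mul' ℂ H ∘ₗ (antipode ℂ).rTensor H))
  have h1 : ∀ t : B ⊗[ℂ] H, TensorProduct.lift ((LinearMap.mul ℂ (B ⊗[ℂ] Smash α)).compl₁₂
      (twistMap β α F (antipode ℂ))
      (TensorProduct.mk ℂ B (Smash α) 1 ∘ₗ (groupHom α).toLinearMap ∘ₗ LinearMap.id)) t =
      P (TensorProduct.assoc ℂ B H H ((coact β).rTensor H t)) := by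
    intro t
    induction t with
    | zero => simp
    | add x y hx hy => simp only [map_add, hx, hy]
    | tmul c h =>
      simp only [TensorProduct.lift.tmul, LinearMap.compl₁₂_apply, LinearMap.rTensor_tmul,
        twistMap, LinearMap.comp_apply]
      generalize coact β c = s
      induction s with
      | zero => simp
      | add x y hx hy =>
        simp only [TensorProduct.add_tmul, map_add, LinearMap.add_apply, hx, hy]
      | tmul u v => simp [P, mul_assoc]
  have h2 : ∀ t : B ⊗[ℂ] H, P ((comul (R := ℂ)).lTensor B t) =
      F (TensorProduct.rid ℂ B ((counit (R := ℂ)).lTensor B t)) := by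
    intro t
    induction t with
    | zero => simp
    | add x y hx hy => simp only [map_add, hx, hy]
    | tmul c h =>
      have h3 : (1 : B) ⊗ₜ[ℂ] (1 : Smash α) = 1 := rfl
      simp [P, Algebra.algebraMap_eq_smul_one, h3]
  ext b
  refine (h1 (coact β b)).trans ?_
  rw [coact_coassoc, h2, rid_counit_coact]

/-- The exchange relation solved for `a F(b)`: `F(b₀)(S(b₁) · a) = (b₁ S(b₂) · a) F(b₀) = a F(b)`.
-/
theorem IsTwisted.mul_antipode {F : B →ₗ[ℂ] B ⊗[ℂ] Smash α} (hF : IsTwisted β α F) (b : B)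
    (a : A) : TensorProduct.lift ((LinearMap.mul ℂ (B ⊗[ℂ] Smash α)).compl₁₂ F
      (TensorProduct.mk ℂ B (Smash α) 1 ∘ₗ (Smash.ofLeft α).toAlgHom.toLinearMap ∘ₗ
        orbit α a ∘ₗ antipode ℂ)) (coact β b) = ((1 : B) ⊗ₜ Smash.ofLeft α a) * F b := by
  let X : B ⊗[ℂ] (H ⊗[ℂ] H) →ₗ[ℂ] B ⊗[ℂ] Smash α :=
    TensorProduct.lift ((LinearMap.mul ℂ (B ⊗[ℂ] Smash α)).flip.compl₁₂ F
      (TensorProduct.mk ℂ B (Smash α) 1 ∘ₗ (Smash.ofLeft α).toAlgHom.toLinearMap ∘ₗ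
        orbit α a ∘ₗ LinearMap.mul' ℂ H ∘ₗ (antipode ℂ).lTensor H))
  have h1 : ∀ t : B ⊗[ℂ] H, TensorProduct.lift ((LinearMap.mul ℂ (B ⊗[ℂ] Smash α)).compl₁₂ F
      (TensorProduct.mk ℂ B (Smash α) 1 ∘ₗ (Smash.ofLeft α).toAlgHom.toLinearMap ∘ₗ
        orbit α a ∘ₗ antipode ℂ)) t =
      X (TensorProduct.assoc ℂ B H H ((coact β).rTensor H t)) := by
    intro t
    induction t with
    | zero => simp
    | add x y hx hy => simp only [map_add, hx, hy]
    | tmul c h =>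
      refine (hF c (orbit α a (antipode ℂ h))).trans ?_
      rw [LinearMap.rTensor_tmul]
      generalize coact β c = s
      induction s with
      | zero => simp
      | add x y hx hy => simp only [TensorProduct.add_tmul, map_add, hx, hy]
      | tmul u v => simp [X, orbit_orbit]
  have h2 : ∀ t : B ⊗[ℂ] H, X ((comul (R := ℂ)).lTensor B t) = ((1 : B) ⊗ₜ Smash.ofLeft α a) *
      F (TensorProduct.rid ℂ B ((counit (R := ℂ)).lTensor B t)) := by
    intro t
    induction t with
    | zero => simp
    | add x y hx hy => simp only [map_add, mul_add, hx, hy]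
    | tmul c h => simp [X, Algebra.algebraMap_eq_smul_one, orbit_one]
  rw [h1, coact_coassoc, h2, rid_counit_coact]

/-- Moving `a` to the left past `S(b₁)` and then past `F` cancels the two twists: `F(b₀) S(b₁) a =
F(b₀)(S(b₁) · a) S(b₂) = a F(b₀) S(b₁)`. The last step is `IsTwisted.mul_antipode`. This puts the
corrected map within reach of outerness. -/
theorem IsTwisted.twistMap_commute {F : B →ₗ[ℂ] B ⊗[ℂ] Smash α} (hF : IsTwisted β α F) (b : B)
    (a : A) : twistMap β α F (antipode ℂ) b * ((1 : B) ⊗ₜ Smash.ofLeft α a) =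
      ((1 : B) ⊗ₜ Smash.ofLeft α a) * twistMap β α F (antipode ℂ) b := by
  let ν : H →ₗ[ℂ] B ⊗[ℂ] Smash α :=
    TensorProduct.mk ℂ B (Smash α) 1 ∘ₗ (groupHom α).toLinearMap ∘ₗ antipode ℂ
  let μ : H →ₗ[ℂ] B ⊗[ℂ] Smash α := TensorProduct.mk ℂ B (Smash α) 1 ∘ₗ
    (Smash.ofLeft α).toAlgHom.toLinearMap ∘ₗ orbit α a ∘ₗ antipode ℂ
  let P : B ⊗[ℂ] (H ⊗[ℂ] H) →ₗ[ℂ] B ⊗[ℂ] Smash α :=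
    TensorProduct.lift ((LinearMap.mul ℂ (B ⊗[ℂ] Smash α)).compl₁₂ F
      (TensorProduct.lift ((LinearMap.mul ℂ (B ⊗[ℂ] Smash α)).compl₁₂ μ ν)))
  have h0 : ∀ h : H, ν h * ((1 : B) ⊗ₜ Smash.ofLeft α a) =
      TensorProduct.lift ((LinearMap.mul ℂ (B ⊗[ℂ] Smash α)).compl₁₂ μ ν)
        (comul (R := ℂ) h) := by
    intro h
    change ((1 : B) ⊗ₜ[ℂ] groupHom α (antipode ℂ h)) * _ = _
    rw [Algebra.TensorProduct.tmul_mul_tmul, one_mul, groupHom_antipode_mul_ofLeft]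
    generalize comul (R := ℂ) h = t
    induction t with
    | zero => simp
    | add x y hx hy => simp only [TensorProduct.tmul_add, map_add, hx, hy]
    | tmul u v => simp [μ, ν]
  have h1 : ∀ t : B ⊗[ℂ] H, TensorProduct.lift ((LinearMap.mul ℂ (B ⊗[ℂ] Smash α)).compl₁₂ F ν) t *
      ((1 : B) ⊗ₜ Smash.ofLeft α a) = P ((comul (R := ℂ)).lTensor B t) := by
    intro t
    induction t with
    | zero => simp
    | add x y hx hy => simp only [map_add, add_mul, hx, hy]
    | tmul c h =>
      change F c * ν h * _ = F c * _
      rw [mul_assoc, h0]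
  have h2 : ∀ t : B ⊗[ℂ] H, P (TensorProduct.assoc ℂ B H H ((coact β).rTensor H t)) =
      ((1 : B) ⊗ₜ Smash.ofLeft α a) *
        TensorProduct.lift ((LinearMap.mul ℂ (B ⊗[ℂ] Smash α)).compl₁₂ F ν) t := by
    intro t
    induction t with
    | zero => simp
    | add x y hx hy => simp only [map_add, mul_add, hx, hy]
    | tmul c h =>
      have h3 : ∀ s : B ⊗[ℂ] H, P (TensorProduct.assoc ℂ B H H (s ⊗ₜ h)) =
          TensorProduct.lift ((LinearMap.mul ℂ (B ⊗[ℂ] Smash α)).compl₁₂ F μ) s * ν h := by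
        intro s
        induction s with
        | zero => simp
        | add x y hx hy => simp only [TensorProduct.add_tmul, map_add, add_mul, hx, hy]
        | tmul u v => exact (mul_assoc _ _ _).symm
      rw [LinearMap.rTensor_tmul, h3, hF.mul_antipode, mul_assoc]
      rfl
  refine (h1 (coact β b)).trans ?_
  rw [← coact_coassoc, h2]
  rfl

theorem lTensor_groupHom_injective [Nontrivial A] :
    Function.Injective ((groupHom α).toLinearMap.lTensor B) := by
  obtain ⟨v, hv⟩ := Smash.exists_ofRightHom_leftInverse α
  have h : Function.LeftInverse (((Cop.of H).symm.toLinearMap ∘ₗ v).lTensor B)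
      ((groupHom α).toLinearMap.lTensor B) := by
    intro t
    induction t with
    | zero => simp
    | add x y hx hy => simp only [map_add, hx, hy]
    | tmul b s => simp [groupHom_apply, hv]
  exact h.injective

/-- The structure of the twisted maps with values in the invariants. -/
theorem IsTwisted.exists_eq_embed [Nontrivial A] (hα : α.IsOuter) {F : B →ₗ[ℂ] B ⊗[ℂ] Smash α}
    (hF : IsTwisted β α F) (hinv : ∀ b, F b ∈ invariants β α) :
    ∃ T : Module.End ℂ B, (∀ b, β.toStarAlgHom (T b) = T.rTensor H (β.toStarAlgHom b)) ∧
      ∀ b, F b = embed β α (T b) := by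
  obtain ⟨v, hv⟩ := Smash.exists_ofRightHom_leftInverse α
  have h0 : ∀ b, ∃ c : B, twistMap β α F (antipode ℂ) b = c ⊗ₜ 1 := fun b =>
    Smash.exists_eq_tmul_one_of_commute α hα _ (hF.twistMap_commute β α b)
  -- Outerness gives each `c` only pointwise. Slicing the second leg by `ε ∘ v`, a functional with
  -- value `1` at `1`, recovers it linearly in `b`.
  let T : B →ₗ[ℂ] B := (TensorProduct.rid ℂ B).toLinearMap ∘ₗ
    ((counit (R := ℂ)) ∘ₗ v).lTensor B ∘ₗ twistMap β α F (antipode ℂ)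
  have h1 : ∀ b, twistMap β α F (antipode ℂ) b = T b ⊗ₜ 1 := by
    intro b
    obtain ⟨c, hc⟩ := h0 b
    have h2 : v 1 = 1 := by
      have := hv 1
      rwa [map_one] at this
    rw [hc]
    simp [T, hc, h2]
  -- First expression for `F`, from undoing the antipode correction: `F(b) = T(b₀) ⊗ (1 ⋊ b₁)`.
  have h2 : ∀ b, F b = (groupHom α).toLinearMap.lTensor B (T.rTensor H (coact β b)) := by
    intro b
    conv_lhs => rw [← twistMap_twistMap β α F]
    rw [twistMap, LinearMap.comp_apply]
    generalize coact β b = t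
    induction t with
    | zero => simp
    | add x y hx hy => simp only [map_add, hx, hy]
    | tmul c h => simp [h1]
  have h4 : ∀ t : B ⊗[ℂ] H, (Smash.counitRight α).lTensor B
      ((groupHom α).toLinearMap.lTensor B (T.rTensor H t)) =
      T (TensorProduct.rid ℂ B ((counit (R := ℂ)).lTensor B t)) ⊗ₜ 1 := by
    intro t
    induction t with
    | zero => simp
    | add x y hx hy => simp only [map_add, TensorProduct.add_tmul, hx, hy]
    | tmul c h =>
      have h5 : Smash.counitRight α (groupHom α h) = counit (R := ℂ) h • (1 : A) :=
        Smash.counitRight_tmul α 1 (Cop.of H h)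
      simp [h5, TensorProduct.smul_tmul']
  -- Second expression, from invariance: `F(b)` is rebuilt from its counit slice, which by the first
  -- expression is `T(b) ⊗ 1`.
  have h5 : ∀ b, F b = embed β α (T b) := by
    intro b
    have h3 := coe_mulEmbed_counitRight β α ⟨F b, hinv b⟩
    change _ = F b at h3
    rw [← h3]
    change ((mulEmbed β α ((Smash.counitRight α).lTensor B (F b)) : invariants β α) :
      B ⊗[ℂ] Smash α) = _
    rw [h2, h4, rid_counit_coact, mulEmbed_tmul, map_one, one_mul, coe_embedInvariants]
  -- Equating the two expressions gives equivariance of `T` after applying the injective inclusion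
  -- of `H` on the second leg.
  refine ⟨T, fun b => lTensor_groupHom_injective α ?_, h5⟩
  rw [← embed_apply, ← h5, h2]
  rfl

end Invariants
end Invariants

/-! ### Commuting with the dual is equivariance. -/

section Equivariance

variable {H B : Type*} [Ring H] [StarRing H] [HopfAlgebra ℂ H] [HopfStarAlgebra H]
  [Ring B] [StarRing B] [Algebra ℂ B] [StarModule ℂ B] (β : Coaction B H)

theorem Coaction.dualAction_apply (ω : H →ₗ[ℂ] ℂ) (b : B) : β.dualAction ω b =
    TensorProduct.rid ℂ B (ω.lTensor B (β.toStarAlgHom b)) := rfl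

/-- The functionals `τ(· S(h))` separate the points of `B ⊗ H`. -/
theorem eq_zero_of_forall_dualCop {H B : Type*} [Ring H] [StarRing H] [HopfAlgebra ℂ H]
    [InvolutiveAntipode H] [Ring B] [Algebra ℂ B] {τ : H →ₗ[ℂ] ℂ} (hτ : IsHaarState τ)
    (z : B ⊗[ℂ] H) (hz : ∀ ω ∈ dualCop τ, TensorProduct.rid ℂ B (ω.lTensor B z) = 0) : z = 0 := by
  classical
  let e := Module.Basis.ofVectorSpace ℂ B
  have h1 : ∀ (ω : H →ₗ[ℂ] ℂ) (y : B ⊗[ℂ] H) i,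
      e.coord i (TensorProduct.rid ℂ B (ω.lTensor B y)) =
        ω (TensorProduct.equivFinsuppOfBasisLeft e y i) := by
    intro ω y i
    induction y with
    | zero => simp
    | add x y hx hy => simp only [map_add, Finsupp.add_apply, hx, hy]
    | tmul b h => simp [mul_comm]
  refine (TensorProduct.equivFinsuppOfBasisLeft e).map_eq_zero_iff.1 (Finsupp.ext fun i => ?_)
  by_contra h
  set k := TensorProduct.equivFinsuppOfBasisLeft e z i with hk
  -- For a nonzero coordinate `k` of `z`, test with `h = S(k^*)`. As `S² = id`, the functional is
  -- `τ(· k^*)`, whose value at `k` is `τ(k k^*) > 0`.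
  obtain ⟨r, hr, hr'⟩ := hτ.pos (star k) (by simpa using h)
  have h2 := h1 (τ ∘ₗ LinearMap.mulRight ℂ (antipode ℂ (antipode ℂ (star k)))) z i
  rw [hz _ ⟨antipode ℂ (star k), fun x => rfl⟩, map_zero, ← hk] at h2
  rw [star_star] at hr'
  simp only [LinearMap.comp_apply, LinearMap.mulRight_apply,
    InvolutiveAntipode.antipode_antipode, hr'] at h2
  exact hr.ne' (Complex.ofReal_eq_zero.1 h2.symm)

theorem dualAction_comp (R : Module.End ℂ B) (ω : H →ₗ[ℂ] ℂ) (b : B) :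
    R (β.dualAction ω b) =
      TensorProduct.rid ℂ B (ω.lTensor B (R.rTensor H (β.toStarAlgHom b))) := by
  rw [Coaction.dualAction_apply]
  generalize β.toStarAlgHom b = t
  induction t with
  | zero => simp
  | add x y hx hy => simp only [map_add, hx, hy]
  | tmul u v => simp

/-- An operator commutes with the action of the dual if and only if it is equivariant. -/
theorem commute_dualAction_iff [InvolutiveAntipode H] {τ : H →ₗ[ℂ] ℂ} (hτ : IsHaarState τ)
    (R : Module.End ℂ B) : (∀ T ∈ β.dualAction '' dualCop τ, R * T = T * R) ↔
      ∀ b, β.toStarAlgHom (R b) = R.rTensor H (β.toStarAlgHom b) := by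
  constructor
  · intro h b
    rw [← sub_eq_zero]
    refine eq_zero_of_forall_dualCop hτ _ fun ω hω => ?_
    rw [map_sub, map_sub, ← dualAction_comp, ← Coaction.dualAction_apply, sub_eq_zero]
    exact (LinearMap.congr_fun (h _ ⟨ω, hω, rfl⟩) b).symm
  · rintro h _ ⟨ω, -, rfl⟩
    ext b
    rw [Module.End.mul_apply, Module.End.mul_apply, dualAction_comp, Coaction.dualAction_apply, h]

end Equivariance

/-! ### Actions on the invariants that fix `A` and equivariant actions on `B`. -/

section Invariants

set_option linter.unusedSectionVars false

variable {H A B : Type*} [Ring H] [StarRing H] [HopfAlgebra ℂ H] [HopfStarAlgebra H]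
  [InvolutiveAntipode H] [Ring A] [StarRing A] [Algebra ℂ A] [StarModule ℂ A]
  [Ring B] [StarRing B] [Algebra ℂ B] [StarModule ℂ B]
  (β : Coaction B H) (α : HopfAction (Cop H) A)

namespace Invariants

/-- An operator on the `B`-leg commutes with `homRight`, which does not touch that leg, and with
`homLeft` by equivariance. -/
theorem rTensor_mem {R : Module.End ℂ B}
    (hR : ∀ b, β.toStarAlgHom (R b) = R.rTensor H (β.toStarAlgHom b)) {x : B ⊗[ℂ] Smash α}
    (hx : x ∈ invariants β α) : R.rTensor (Smash α) x ∈ invariants β α := by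
  have hx' := (prodCoaction_eq_iff β α x).1 hx
  refine (prodCoaction_eq_iff β α _).2 ?_
  have h1 : ∀ y : B ⊗[ℂ] Smash α, homRight α (R.rTensor (Smash α) y) =
      R.rTensor (Smash α ⊗[ℂ] Cop H) (homRight α y) := by
    intro y
    induction y with
    | zero => simp
    | add x y hx hy => simp only [map_add, hx, hy]
    | tmul b s => rfl
  have h2 : ∀ y : B ⊗[ℂ] Smash α, homLeft β α (R.rTensor (Smash α) y) =
      R.rTensor (Smash α ⊗[ℂ] Cop H) (homLeft β α y) := by
    intro y
    induction y with
    | zero => simp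
    | add x y hx hy => simp only [map_add, hx, hy]
    | tmul b s =>
      rw [LinearMap.rTensor_tmul, homLeft_tmul, homLeft_tmul, hR]
      generalize β.toStarAlgHom b = t
      induction t with
      | zero => simp
      | add x y hx hy => simp only [map_add, hx, hy]
      | tmul u v => simp
  rw [h1, h2, hx']

theorem rTensor_embed {R : Module.End ℂ B}
    (hR : ∀ b, β.toStarAlgHom (R b) = R.rTensor H (β.toStarAlgHom b)) (b : B) :
    R.rTensor (Smash α) (embed β α b) = embed β α (R b) := by
  rw [embed_apply, embed_apply, hR]
  exact LinearMap.congr_fun ((LinearMap.rTensor_comp_lTensor _ _ _).trans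
    (LinearMap.lTensor_comp_rTensor _ _ _).symm) _

theorem coact_injective : Function.Injective β.toStarAlgHom := fun b c h => by
  rw [← rid_counit_coact β b, ← rid_counit_coact β c]
  exact congrArg (fun t => TensorProduct.rid ℂ B ((counit (R := ℂ)).lTensor B t)) h

theorem embedInvariants_injective [Nontrivial A] : Function.Injective (embedInvariants β α) :=
  fun _ _ h => coact_injective β (lTensor_groupHom_injective α (congrArg Subtype.val h))

/-- A bimodule map of the invariants over `A` preserves `B`. -/
theorem exists_eq_embedInvariants [Nontrivial A] (hα : α.IsOuter)
    {F : Module.End ℂ (invariants β α)}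
    (hl : ∀ a x, F (inclusion β α a * x) = inclusion β α a * F x)
    (hr : ∀ a x, F (x * inclusion β α a) = F x * inclusion β α a) :
    ∃ T : Module.End ℂ B, (∀ b, β.toStarAlgHom (T b) = T.rTensor H (β.toStarAlgHom b)) ∧
      ∀ b, F (embedInvariants β α b) = embedInvariants β α (T b) := by
  let ι : invariants β α →ₗ[ℂ] B ⊗[ℂ] Smash α := (invariants β α).subtype.toAlgHom.toLinearMap
  let F' : B →ₗ[ℂ] B ⊗[ℂ] Smash α := ι ∘ₗ F ∘ₗ (embedInvariants β α).toAlgHom.toLinearMap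
  have hF : IsTwisted β α F' := by
    intro b a
    have h1 : ∀ t : B ⊗[ℂ] H, TensorProduct.lift
        ((LinearMap.mul ℂ (B ⊗[ℂ] Smash α)).flip.compl₁₂ F'
        (TensorProduct.mk ℂ B (Smash α) 1 ∘ₗ (Smash.ofLeft α).toAlgHom.toLinearMap ∘ₗ
          orbit α a)) t =
        ι (F (mulEmbed β α ((orbit α a).lTensor B t))) := by
      intro t
      induction t with
      | zero => simp
      | add x y hx hy => simp only [map_add, hx, hy]
      | tmul c h =>
        rw [LinearMap.lTensor_tmul, mulEmbed_tmul, hl]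
        rfl
    have h2 : ∀ t : B ⊗[ℂ] H, TensorProduct.lift
        ((LinearMap.mul ℂ (B ⊗[ℂ] Smash α)).flip.compl₁₂ (embed β α).toAlgHom.toLinearMap
        (TensorProduct.mk ℂ B (Smash α) 1 ∘ₗ (Smash.ofLeft α).toAlgHom.toLinearMap ∘ₗ
          orbit α a)) t =
        ι (mulEmbed β α ((orbit α a).lTensor B t)) := by
      intro t
      induction t with
      | zero => simp
      | add x y hx hy => simp only [map_add, hx, hy]
      | tmul c h => rfl
    -- The exchange relation for `embed` holds inside the invariants. Applying `F` to it and pulling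
    -- `A` out on the right on one side, on the left on the other, yields the relation for `F'`.
    have h3 : embedInvariants β α b * inclusion β α a =
        mulEmbed β α ((orbit α a).lTensor B (coact β b)) :=
      Subtype.ext ((isTwisted_embed β α b a).trans (h2 _))
    rw [h1, ← h3, hr]
    rfl
  obtain ⟨T, hT, hc⟩ := hF.exists_eq_embed β α hα fun b => (F (embedInvariants β α b)).2
  exact ⟨T, hT, fun b => Subtype.ext (hc b)⟩

/-- A Hopf `*`-algebra acting on `B` by equivariant operators acts on the invariants. -/
noncomputable def inducedAction {Q : Type*} [Ring Q] [StarRing Q] [HopfAlgebra ℂ Q]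
    (ρ : HopfAction Q B)
    (hρ : ∀ q b, β.toStarAlgHom (ρ.toAlgHom q b) = (ρ.toAlgHom q).rTensor H (β.toStarAlgHom b)) :
    HopfAction Q (invariants β α) :=
  (ρ.rTensor (Smash α)).ofInjective (invariants β α).subtype Subtype.val_injective
    { toFun := fun q =>
        { toFun := fun x => ⟨(ρ.toAlgHom q).rTensor (Smash α) x, rTensor_mem β α (hρ q) x.2⟩
          map_add' := fun _ _ => Subtype.ext (map_add _ _ _)
          map_smul' := fun c _ => Subtype.ext (map_smul _ c _) }
      map_add' := fun p q => LinearMap.ext fun x => Subtype.ext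
        (LinearMap.congr_fun (map_add (ρ.rTensor (Smash α)).toAlgHom p q) x)
      map_smul' := fun c q => LinearMap.ext fun x => Subtype.ext
        (LinearMap.congr_fun (map_smul (ρ.rTensor (Smash α)).toAlgHom c q) x) }
    (fun _ _ => rfl)

variable {Q : Type*} [Ring Q] [StarRing Q] [HopfAlgebra ℂ Q] {ρ : HopfAction Q B}
  (hρ : ∀ q b, β.toStarAlgHom (ρ.toAlgHom q b) = (ρ.toAlgHom q).rTensor H (β.toStarAlgHom b))

theorem coe_inducedAction (q : Q) (x : invariants β α) :
    ((inducedAction β α ρ hρ).toAlgHom q x : B ⊗[ℂ] Smash α) =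
      (ρ.toAlgHom q).rTensor (Smash α) x := rfl

theorem inducedAction_embedInvariants (q : Q) (b : B) :
    (inducedAction β α ρ hρ).toAlgHom q (embedInvariants β α b) =
      embedInvariants β α (ρ.toAlgHom q b) :=
  Subtype.ext (rTensor_embed β α (hρ q) b)

theorem inducedAction_fixes : (inducedAction β α ρ hρ).Fixes (inclusion β α) := by
  intro q a
  apply Subtype.ext
  rw [coe_inducedAction]
  change (ρ.toAlgHom q 1) ⊗ₜ Smash.ofLeft α a = counit (R := ℂ) q • ((1 : B) ⊗ₜ Smash.ofLeft α a)
  rw [ρ.map_one', TensorProduct.smul_tmul']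

/-- Two actions on the invariants that fix `A` agree if they agree on `B`. -/
theorem action_ext {Q₁ Q₂ : Type*} [Ring Q₁] [StarRing Q₁] [HopfAlgebra ℂ Q₁] [Ring Q₂]
    [StarRing Q₂] [HopfAlgebra ℂ Q₂] {ρ₁ : HopfAction Q₁ (invariants β α)}
    {ρ₂ : HopfAction Q₂ (invariants β α)} (h₁ : ρ₁.Fixes (inclusion β α))
    (h₂ : ρ₂.Fixes (inclusion β α)) {q₁ : Q₁} {q₂ : Q₂}
    (h : ∀ b, ρ₁.toAlgHom q₁ (embedInvariants β α b) = ρ₂.toAlgHom q₂ (embedInvariants β α b))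
    (x : invariants β α) : ρ₁.toAlgHom q₁ x = ρ₂.toAlgHom q₂ x := by
  obtain ⟨t, rfl⟩ := mulEmbed_surjective β α x
  induction t with
  | zero => simp
  | add x y hx hy => simp only [map_add, hx, hy]
  | tmul b a => rw [mulEmbed_tmul, h₁.map_left_mul, h₂.map_left_mul, h]

/-- An action on the invariants that fixes `A` is induced by an equivariant action on `B`. -/
theorem exists_action_of_fixes [Nontrivial A] (hα : α.IsOuter)
    (σ : HopfAction Q (invariants β α)) (hσ : σ.Fixes (inclusion β α)) :
    ∃ ρ : HopfAction Q B,
      (∀ q b, β.toStarAlgHom (ρ.toAlgHom q b) = (ρ.toAlgHom q).rTensor H (β.toStarAlgHom b)) ∧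
      ∀ q b, σ.toAlgHom q (embedInvariants β α b) = embedInvariants β α (ρ.toAlgHom q b) := by
  let j : B →ₗ[ℂ] invariants β α := (embedInvariants β α).toAlgHom.toLinearMap
  obtain ⟨E, hE⟩ := j.exists_leftInverse_of_injective
    (LinearMap.ker_eq_bot.2 (embedInvariants_injective β α))
  -- The operator attached to each `q` comes from an existence statement. Defining it through a
  -- fixed linear left inverse `E` of the embedding makes it linear in `q`.
  let T : Q →ₗ[ℂ] Module.End ℂ B :=
    { toFun := fun q => E ∘ₗ σ.toAlgHom q ∘ₗ j
      map_add' := fun p q => by ext b; simp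
      map_smul' := fun c q => by ext b; simp }
  have hT : ∀ q, (∀ b, β.toStarAlgHom (T q b) = (T q).rTensor H (β.toStarAlgHom b)) ∧
      ∀ b, σ.toAlgHom q (embedInvariants β α b) = embedInvariants β α (T q b) := by
    intro q
    obtain ⟨R, hR, hR'⟩ := exists_eq_embedInvariants β α hα (F := σ.toAlgHom q)
      (hσ.map_left_mul q) (hσ.map_right_mul q)
    have : T q = R := by
      ext b
      exact (congrArg E (hR' b)).trans (LinearMap.congr_fun hE (R b))
    rw [this]
    exact ⟨hR, hR'⟩
  exact ⟨σ.ofInjective (embedInvariants β α) (embedInvariants_injective β α) T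
    fun q b => ((hT q).2 b).symm, fun q => (hT q).1, fun q => (hT q).2⟩

end Invariants

/-- The centralizer acts on `B` equivariantly, hence on the invariants, and this action is terminal.
A competing action descends to `B`, so the universal property of `Q` classifies it by some `φ`; the
remaining points are that `φ` lands in `K` and is unique there. -/
theorem exists_isHopfCentralizer_quantumGaloisGroupIsoTo [Nontrivial A] {τ : H →ₗ[ℂ] ℂ}
    (hτ : IsHaarState τ) (hα : α.IsOuter) (Q : Type w) [Ring Q] [StarRing Q] [HopfAlgebra ℂ Q]
    [HopfStarAlgebra Q] (ρ : HopfAction Q B) (hQ : IsQuantumAutomorphismGroup Q ρ) :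
    ∃ K : HopfStarSubalgebra Q, IsHopfCentralizer ρ (β.dualAction '' dualCop τ) K ∧
      QuantumGaloisGroupIsoTo (inclusion β α) K.toStarSubalgebra := by
  obtain ⟨K, hK⟩ := HopfStarSubalgebra.exists_isHopfCentralizer ρ (β.dualAction '' dualCop τ)
  refine ⟨K, hK, ?_⟩
  have hρ : ∀ q b, β.toStarAlgHom ((ρ.comp K.val fun _ => rfl).toAlgHom q b) =
      ((ρ.comp K.val fun _ => rfl).toAlgHom q).rTensor H (β.toStarAlgHom b) := fun q =>
    (commute_dualAction_iff β hτ _).1 (hK.commute q q.2)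
  refine quantumGaloisGroupIsoTo_of_isQuantumGaloisGroup
    (σ := Invariants.inducedAction β α _ hρ) ⟨Invariants.inducedAction_fixes β α hρ, ?_⟩
  intro Q' _ _ _ _ σ hσ
  obtain ⟨θ, hθ, hθ'⟩ := Invariants.exists_action_of_fixes β α hα σ hσ
  obtain ⟨φ, ⟨hφ, hφ'⟩, huniq⟩ := hQ.terminal Q' θ θ.fixes_ofId
  -- The range of `φ` is a Hopf `*`-subalgebra acting by equivariant operators, so maximality of `K`
  -- contains it.
  have hφK : ∀ x, φ x ∈ K.toStarSubalgebra := by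
    intro x
    refine hK.largest (HopfStarSubalgebra.range φ hφ) ?_ ⟨x, rfl⟩
    rintro _ ⟨y, rfl⟩
    have hy : ρ.toAlgHom (φ y) = θ.toAlgHom y := LinearMap.ext (hφ' y)
    refine (commute_dualAction_iff β hτ _).2 ?_
    change ∀ b, β.toStarAlgHom (ρ.toAlgHom (φ y) b) = (ρ.toAlgHom (φ y)).rTensor H _
    rw [hy]
    exact hθ y
  refine ⟨K.codRestrict φ hφK, ⟨fun x => Subtype.ext (hφ x), fun q => ?_⟩, ?_⟩
  · refine Invariants.action_ext β α (Invariants.inducedAction_fixes β α hρ) hσ fun b => ?_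
    rw [Invariants.inducedAction_embedInvariants, hθ']
    exact congrArg _ (hφ' q b)
  · rintro ψ ⟨hψ, hψ'⟩
    -- Evaluating on the copy of `B` turns intertwining on the invariants into intertwining on `B`,
    -- where `φ` is unique.
    have h := huniq (K.val.comp ψ) ⟨fun x => congrArg Subtype.val (hψ x), fun q b => ?_⟩
    · exact BialgHom.ext fun x => Subtype.ext (congrArg (fun f : Q' →ₐc[ℂ] Q => f x) h)
    · have h1 := hψ' q (Invariants.embedInvariants β α b)
      rw [Invariants.inducedAction_embedInvariants, hθ'] at h1
      exact Invariants.embedInvariants_injective β α h1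

end Invariants
end QuantumGalois

/-- The second assertion is the first for `A = R`, transported along `Φ`. From the analytic
hypotheses it needs only `R ≠ 0`, which infinite-dimensionality supplies. -/
theorem mainTheorem7
    {H : Type*} [Ring H] [StarRing H] [HopfAlgebra ℂ H] [HopfStarAlgebra H]
    [InvolutiveAntipode H] (τ : H →ₗ[ℂ] ℂ) (hτ : IsHaarState τ) :
    (∀ (A : Type u) [Ring A] [StarRing A] [Algebra ℂ A] [StarModule ℂ A] [Nontrivial A]
        (α : HopfAction (Cop H) A) (_hα : α.IsOuter)
        (B : Type v) [Ring B] [StarRing B] [Algebra ℂ B] [StarModule ℂ B]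
        [FiniteDimensional ℂ B] (β : Coaction B H)
        (Q : Type w) [Ring Q] [StarRing Q] [HopfAlgebra ℂ Q] [HopfStarAlgebra Q]
        (ρ : HopfAction Q B) (_hQ : IsQuantumAutomorphismGroup Q ρ),
      ∃ K : HopfStarSubalgebra Q,
        IsHopfCentralizer ρ (β.dualAction '' dualCop τ) K ∧
        QuantumGaloisGroupIsoTo (inclusion β α) K.toStarSubalgebra) ∧
    (∀ (𝓗 : Type u) [NormedAddCommGroup 𝓗] [InnerProductSpace ℂ 𝓗] [CompleteSpace 𝓗]
        (R M : VonNeumannAlgebra 𝓗) (_hR : IsHyperfiniteII₁Factor R) (_hM : IsII₁Factor M)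
        (hRM : R.toStarSubalgebra ≤ M.toStarSubalgebra)
        (α : HopfAction (Cop H) R.toStarSubalgebra) (_hα : α.IsOuter)
        (P : Type v) [CStarAlgebra P] [FiniteDimensional ℂ P] (β : Coaction P H)
        (Φ : M.toStarSubalgebra ≃⋆ₐ[ℂ] invariants β α)
        (_hΦ : ∀ r : R.toStarSubalgebra,
          Φ (StarSubalgebra.inclusion hRM r) = inclusion β α r)
        (Q : Type w) [Ring Q] [StarRing Q] [HopfAlgebra ℂ Q] [HopfStarAlgebra Q]
        (ρ : HopfAction Q P) (_hQ : IsQuantumAutomorphismGroup Q ρ),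
      ∃ K : HopfStarSubalgebra Q,
        IsHopfCentralizer ρ (β.dualAction '' dualCop τ) K ∧
        QuantumGaloisGroupIsoTo (StarSubalgebra.inclusion hRM) K.toStarSubalgebra) := by
  refine ⟨fun A _ _ _ _ _ α hα B _ _ _ _ _ β Q _ _ _ _ ρ hQ =>
    exists_isHopfCentralizer_quantumGaloisGroupIsoTo β α hτ hα Q ρ hQ, ?_⟩
  intro 𝓗 _ _ _ R M hR _ hRM α hα P _ _ β Φ hΦ Q _ _ _ _ ρ hQ
  have : Nontrivial R.toStarSubalgebra := by
    by_contra h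
    rw [not_nontrivial_iff_subsingleton] at h
    exact hR.infiniteDimensional inferInstance
  obtain ⟨K, hK, hK'⟩ :=
    exists_isHopfCentralizer_quantumGaloisGroupIsoTo β α hτ hα Q ρ hQ
  exact ⟨K, hK, hK'.transport Φ hΦ⟩
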